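/- Let $p$ be a prime, and let $v_p$ be the $p$-adic valuation on $\mathbf{C}_p$ with $v_p(p)=1$, $v_p(0)=+\infty$. Let $C(t)=\{x\in\mathbf{C}_p : v_p(x)=t\}$. For a nonzero power series $F=\sum_{i\ge 0}F_iX^i\in\mathbf{C}_p[[X]]$, the characteristic sequence $k_0<k_1<\cdots$ (finite or infinite) is defined as follows: $k_0$ is the least index with $F_{k_0}\neq 0$ (so $k_0=0$ if $F(0)\ne0$), and $k_n$ is the largest integer $i>k_{n-1}$ at which $\dfrac{v_p(F_{k_{n-1}})-v_p(F_i)}{i-k_{n-1}}$ attains its maximum over all integers $i>k_{n-1}$; the sequence stops at $k_{n-1}$ if there is no such largest integer. For $n\ge 1$ put $\alpha_n=\dfrac{v_p(F_{k_{n-1}})-v_p(F_{k_n})}{k_n-k_{n-1}}$. Let $G=\sum_{i\ge 0} G_iX^i\in\mathbf{C}_p[[X]]$ be another nonzero power series, with characteristic sequence $(l_m)$ and corresponding valuations $(\beta_m)$. Let $\mathscr{C}(F,t)=\prod_{F(z)=0,\ v_p(z)=t}(X-z)$, zeros being repeated according to multiplicity, and let $\phi(x)=\min(v_p(F(x)),v_p(G(x)))$.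 Theorem. Let $n,m\ge 1$ be such that $k_n$ and $l_m$ exist and $\alpha_n=\beta_m$, and suppose that $F$ and $G$ converge on the circle $C(\alpha_n)$. Put $$a=\min\{v_p(F_{k_n})+k_{n-1}\alpha_n,\ v_p(G_{l_m})+l_{m-1}\alpha_n\},\qquad b=\max\{v_p(F_{k_n})+k_{n-1}\alpha_n,\ v_p(G_{l_m})+l_{m-1}\alpha_n\},$$ and $r=\mathrm{Res}(\mathscr{C}(F,\alpha_n),\mathscr{C}(G,\beta_m))$. Then $\phi$ attains a maximum on $C(\alpha_n)$ (in $\mathbf{R}\cup\{+\infty\}$), and $$a+\frac{v_p(r)}{\min\{l_m-l_{m-1},\,k_n-k_{n-1}\}}\ \le\ \max_{x\in C(\alpha_n)}\phi(x).$$ If moreover $\alpha_n\ge 0$, i.e. the circle lies in the closed unit disc, then $$\max_{x\in C(\alpha_n)}\phi(x)\ \le\ b+v_p(r).$$ If in addition $F,G\in K[[X]]$, where $K\subset\mathbf{C}_p$ is a finite extension of $\mathbf{Q}_p$ with uniformizer $\pi$, and $v_\pi$ is the valuation of $K$ with $v_\pi(\pi)=1$, then $$\max_{x\in C(\alpha_n)}\phi(x)\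 \le\ b+c\,v_p(r),$$ $$c=\max\left\{\frac{\gcd(v_\pi(F_{k_n})-v_\pi(F_{k_{n-1}}),\,k_n-k_{n-1})}{k_n-k_{n-1}},\ \frac{\gcd(v_\pi(G_{l_m})-v_\pi(G_{l_{m-1}}),\,l_m-l_{m-1})}{l_m-l_{m-1}}\right\}.$$ -/

import Mathlib

noncomputable section

/-- The `p`-adic valuation on `ℂ_[p]`, normalized by `v_p(p) = 1`, with `v_p(0) = ∞`. -/
def vp {p : ℕ} [Fact p.Prime] (x : ℂ_[p]) : EReal :=
  open Classical in if x = 0 then ⊤ else ((-Real.logb (p : ℝ) ‖x‖ : ℝ) : EReal)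

/-- The circle `C(t) = {x ∈ ℂ_[p] : v_p(x) = t}`. -/
def circleC (p : ℕ) [Fact p.Prime] (t : EReal) : Set ℂ_[p] := {x | vp x = t}

/-- The power series `F` converges at the point `x`. -/
def ConvergesAt {p : ℕ} [Fact p.Prime] (F : PowerSeries ℂ_[p]) (x : ℂ_[p]) : Prop :=
  Summable fun i : ℕ => PowerSeries.coeff i F * x ^ i

/-- The value `F(x) = ∑ F_i x ^ i`, meaningful where `F` converges. -/
def psEval {p : ℕ} [Fact p.Prime] (F : PowerSeries ℂ_[p]) (x : ℂ_[p]) : ℂ_[p] :=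
  ∑' i : ℕ, PowerSeries.coeff i F * x ^ i

/-- `φ(x) = min(v_p(F(x)), v_p(G(x)))`. -/
def phi {p : ℕ} [Fact p.Prime] (F G : PowerSeries ℂ_[p]) (x : ℂ_[p]) : EReal :=
  min (vp (psEval F x)) (vp (psEval G x))

/-- `(v_p(F_j) - v_p(F_i)) / (i - j)`, used for `j < i` and `F_j ≠ 0`; it is `-∞` if `F_i = 0`. -/
def quot {p : ℕ} [Fact p.Prime] (F : PowerSeries ℂ_[p]) (j i : ℕ) : EReal :=
  (vp (PowerSeries.coeff j F) - vp (PowerSeries.coeff i F)) / (((i : ℝ) - (j : ℝ) : ℝ) : EReal)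

/-- `k` is the term that follows `j` in the characteristic sequence: the largest of the integers
`i > j` at which `quot F j` is maximal. There is none if infinitely many integers attain the
maximum, or if the maximum is not attained: then the sequence ends with `j`. -/
def IsNextIndex {p : ℕ} [Fact p.Prime] (F : PowerSeries ℂ_[p]) (j k : ℕ) : Prop :=
  IsGreatest {i : ℕ | j < i ∧ ∀ i' : ℕ, j < i' → quot F j i' ≤ quot F j i} k

/-- `k 0, …, k n` are the first `n + 1` terms of the characteristic sequence of `F` (in particular
that sequence has at least `n + 1` terms). The first term is the least index of a nonzero
coefficient, which is `0` if `F(0) ≠ 0`. -/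
def IsCharSeq {p : ℕ} [Fact p.Prime] (F : PowerSeries ℂ_[p]) (k : ℕ → ℕ) (n : ℕ) : Prop :=
  IsLeast {i : ℕ | PowerSeries.coeff i F ≠ 0} (k 0) ∧ ∀ i < n, IsNextIndex F (k i) (k (i + 1))

/-- `α_n = (v_p(F_{k_{n-1}}) - v_p(F_{k_n})) / (k_n - k_{n-1})`, for `n ≥ 1`. -/
def rootVal {p : ℕ} [Fact p.Prime] (F : PowerSeries ℂ_[p]) (k : ℕ → ℕ) (n : ℕ) : EReal :=
  quot F (k (n - 1)) (k n)

/-- `v_p(F_{k_n}) + k_{n-1} α_n`, for `n ≥ 1`. -/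
def shiftedVal {p : ℕ} [Fact p.Prime] (F : PowerSeries ℂ_[p]) (k : ℕ → ℕ) (n : ℕ) : EReal :=
  vp (PowerSeries.coeff (k n) F) + (((k (n - 1) : ℕ) : ℝ) : EReal) * rootVal F k n

/-- The distinguished polynomial of `F` in the circle `C(t)`: the product of `X - z` over the zeros
`z` of `F` with `v_p(z) = t`, each repeated according to its multiplicity. -/
def circlePoly {p : ℕ} [Fact p.Prime] (F : PowerSeries ℂ_[p]) (t : EReal) : Polynomial ℂ_[p] :=
  ∏ᶠ z ∈ {z : ℂ_[p] | z ∈ circleC p t ∧ psEval F z = 0},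
    (Polynomial.X - Polynomial.C z) ^ analyticOrderNatAt (psEval F) z

/-- `ϖ` is a uniformizer of `K`: a generator of the maximal ideal of its ring of integers. -/
def IsUnif {p : ℕ} [Fact p.Prime] (K : IntermediateField ℚ_[p] ℂ_[p]) (ϖ : ℂ_[p]) : Prop :=
  ϖ ∈ K ∧ ϖ ≠ 0 ∧ ‖ϖ‖ < 1 ∧ ∀ x ∈ K, ‖x‖ < 1 → ‖x‖ ≤ ‖ϖ‖

/-- The `ϖ`-adic valuation `v_ϖ(x)` of a nonzero `x ∈ K`, where `ϖ` is a uniformizer of `K`: the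
unique integer `d` with `|x| = |ϖ| ^ d`. -/
def vPi {p : ℕ} [Fact p.Prime] (ϖ x : ℂ_[p]) : ℤ :=
  open Classical in if h : ∃ d : ℤ, ‖x‖ = ‖ϖ‖ ^ d then h.choose else 0

/-- `gcd(v_ϖ(F_{k_n}) - v_ϖ(F_{k_{n-1}}), k_n - k_{n-1}) / (k_n - k_{n-1})`, for `n ≥ 1`. -/
def gcdRatio {p : ℕ} [Fact p.Prime] (ϖ : ℂ_[p]) (F : PowerSeries ℂ_[p]) (k : ℕ → ℕ) (n : ℕ) : ℝ :=
  (Int.gcd (vPi ϖ (PowerSeries.coeff (k n) F) - vPi ϖ (PowerSeries.coeff (k (n - 1)) F))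
      ((k n : ℤ) - (k (n - 1) : ℤ)) : ℝ) /
    ((k n : ℝ) - (k (n - 1) : ℝ))

end

/-! Put ρ = p^(-α) with α = α_n. On |x| = ρ the terms of F of maximal absolute value have indices
between s = k_{n-1} and t = k_n. Hence F has exactly t - s zeros on the circle, and |F(x)| = |F_t|
ρ^s ∏ |x - z| over these zeros (`GaussInterval.circlePoly`). The constant has valuation v_p(F_{k_n})
+ k_{n-1} α_n. The same holds for G, so φ depends only on the distances from x to the two multisets
of zeros Z and W, while |r| = ∏_{z ∈ Z} ∏_{w ∈ W} |z - w|.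

Let y be a point of Z ∪ W nearest to x. Then |y - w| ≤ max(|x - w|, |x - y|) = |x - w| for every w
in Z ∪ W, so passing from x to y decreases no valuation (`exists_mem_distProd_le`). Thus φ is
maximal at one of finitely many points, where one of the two series vanishes.

Lower bound: r is a product of one factor per point of the smaller multiset, and at some point that
factor has at least the average valuation. Upper bound: if ρ ≤ 1 every distance is at most 1, so |r|
is at most any single factor.

Over K, the conjugates of a zero y are zeros at which the other polynomial has the same absolute
value. So |r| is at most the factor at y to the power deg y, and this degree is at least 1/c because
the norm of y is an element of K, with an integral valuation (`IsUnif.dvd_natDegree_mul_gcd`). The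
argument is run on truncations of F and G, which are polynomials over K, and passed to the limit. -/

/-! ### Dominant terms on a circle. -/

section GaussInterval

variable {𝕜 : Type*} [NormedField 𝕜]

/-- The terms `f i * x ^ i` of maximal norm on the circle `‖x‖ = ρ` have indices between `s` and
`t`, and these two terms have maximal norm. -/
structure GaussInterval (ρ : ℝ) (f : ℕ → 𝕜) (s t : ℕ) : Prop where
  ne_zero : f s ≠ 0
  eq : ‖f t‖ * ρ ^ t = ‖f s‖ * ρ ^ s
  le : ∀ i, ‖f i‖ * ρ ^ i ≤ ‖f s‖ * ρ ^ s
  lt_left : ∀ i < s, ‖f i‖ * ρ ^ i < ‖f s‖ * ρ ^ s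
  lt_right : ∀ i, t < i → ‖f i‖ * ρ ^ i < ‖f s‖ * ρ ^ s

namespace GaussInterval

variable {ρ : ℝ} {f : ℕ → 𝕜} {s t s' t' : ℕ}

theorem pos (h : GaussInterval ρ f s t) (hρ : 0 < ρ) : 0 < ‖f s‖ * ρ ^ s :=
  mul_pos (norm_pos_iff.2 h.ne_zero) (pow_pos hρ s)

theorem index_le (h : GaussInterval ρ f s t) : s ≤ t := by
  by_contra! hlt
  exact (h.lt_left t hlt).ne h.eq

theorem unique (h : GaussInterval ρ f s t) (h' : GaussInterval ρ f s' t') : s = s' ∧ t = t' := by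
  have e : ‖f s‖ * ρ ^ s = ‖f s'‖ * ρ ^ s' := le_antisymm (h'.le s) (h.le s')
  refine ⟨?_, ?_⟩
  · rcases lt_trichotomy s s' with hlt | heq | hlt
    · exact absurd e (h'.lt_left s hlt).ne
    · exact heq
    · exact absurd e.symm (h.lt_left s' hlt).ne
  · rcases lt_trichotomy t t' with hlt | heq | hlt
    · exact absurd (h'.eq.trans e.symm) (h.lt_right t' hlt).ne
    · exact heq
    · exact absurd (h.eq.trans e) (h'.lt_right t hlt).ne

end GaussInterval

variable [IsUltrametricDist 𝕜]

theorem norm_sub_le_max_norm (a b : 𝕜) : ‖a - b‖ ≤ max ‖a‖ ‖b‖ := by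
  simpa [sub_eq_add_neg] using IsUltrametricDist.norm_add_le_max a (-b)

theorem norm_sub_eq_left_of_lt {a b : 𝕜} (h : ‖b‖ < ‖a‖) : ‖a - b‖ = ‖a‖ := by
  rw [sub_eq_add_neg, IsUltrametricDist.norm_add_eq_max_of_norm_ne_norm (by rw [norm_neg]; exact h.ne'),
    norm_neg, max_eq_left h.le]

theorem norm_sub_eq_right_of_lt {a b : 𝕜} (h : ‖a‖ < ‖b‖) : ‖a - b‖ = ‖b‖ := by
  rw [sub_eq_add_neg, IsUltrametricDist.norm_add_eq_max_of_norm_ne_norm (by rw [norm_neg]; exact h.ne),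
    norm_neg, max_eq_right h.le]

/-! ### Multiplication by X - z: `g` holds the coefficients of the product. -/

section LinearFactor

variable {ρ : ℝ} {f g : ℕ → 𝕜} {s t : ℕ} {z : 𝕜}

omit [IsUltrametricDist 𝕜] in
theorem weight_zero (hg : g 0 = -(z * f 0)) : ‖g 0‖ * ρ ^ 0 = ‖z‖ * (‖f 0‖ * ρ ^ 0) := by
  rw [hg, norm_neg, norm_mul]; ring

theorem weight_succ_le (hρ : 0 < ρ) {i : ℕ} (hg : g (i + 1) = f i - z * f (i + 1)) :
    ‖g (i + 1)‖ * ρ ^ (i + 1) ≤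
      max (ρ * (‖f i‖ * ρ ^ i)) (‖z‖ * (‖f (i + 1)‖ * ρ ^ (i + 1))) := by
  have h : ‖g (i + 1)‖ ≤ max ‖f i‖ (‖z‖ * ‖f (i + 1)‖) := by
    rw [hg, ← norm_mul]; exact norm_sub_le_max_norm _ _
  calc _ ≤ max ‖f i‖ (‖z‖ * ‖f (i + 1)‖) * ρ ^ (i + 1) := by gcongr
    _ = _ := by rw [max_mul_of_nonneg _ _ (by positivity)]; congr 1 <;> ring

theorem weight_succ_left (hρ : 0 < ρ) {i : ℕ} (hg : g (i + 1) = f i - z * f (i + 1))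
    (h : ‖z‖ * (‖f (i + 1)‖ * ρ ^ (i + 1)) < ρ * (‖f i‖ * ρ ^ i)) :
    ‖g (i + 1)‖ * ρ ^ (i + 1) = ρ * (‖f i‖ * ρ ^ i) := by
  have h' : ‖z * f (i + 1)‖ < ‖f i‖ := by
    refine lt_of_mul_lt_mul_right (a := ρ ^ (i + 1)) ?_ (by positivity)
    rw [norm_mul]
    calc _ = ‖z‖ * (‖f (i + 1)‖ * ρ ^ (i + 1)) := by ring
      _ < _ := h
      _ = _ := by ring
  rw [hg, norm_sub_eq_left_of_lt h']; ring

theorem weight_succ_right (hρ : 0 < ρ) {i : ℕ} (hg : g (i + 1) = f i - z * f (i + 1))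
    (h : ρ * (‖f i‖ * ρ ^ i) < ‖z‖ * (‖f (i + 1)‖ * ρ ^ (i + 1))) :
    ‖g (i + 1)‖ * ρ ^ (i + 1) = ‖z‖ * (‖f (i + 1)‖ * ρ ^ (i + 1)) := by
  have h' : ‖f i‖ < ‖z * f (i + 1)‖ := by
    refine lt_of_mul_lt_mul_right (a := ρ ^ (i + 1)) ?_ (by positivity)
    rw [norm_mul]
    calc _ = ρ * (‖f i‖ * ρ ^ i) := by ring
      _ < _ := h
      _ = _ := by ring
  rw [hg, norm_sub_eq_right_of_lt h', norm_mul]; ring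

variable (hρ : 0 < ρ) (h0 : g 0 = -(z * f 0)) (hg : ∀ i, g (i + 1) = f i - z * f (i + 1))
  (h : GaussInterval ρ f s t)

omit [IsUltrametricDist 𝕜] in
theorem GaussInterval.of_weights (hM : ∃ M, 0 < M ∧ (‖g s‖ * ρ ^ s = M) ∧ (‖g t‖ * ρ ^ t = M) ∧
    (∀ i, ‖g i‖ * ρ ^ i ≤ M) ∧ (∀ i < s, ‖g i‖ * ρ ^ i < M) ∧ ∀ i, t < i → ‖g i‖ * ρ ^ i < M) :
    GaussInterval ρ g s t := by
  obtain ⟨M, h0, hs, ht, h1, h2, h3⟩ := hM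
  exact ⟨fun h => by simp [h] at hs; exact h0.ne hs, by rw [hs, ht], by rwa [hs], by rwa [hs],
    by rwa [hs]⟩

include hρ h0 hg h

/-- Multiplication by a linear factor whose root is outside the circle. -/
theorem GaussInterval.linear_gt (hz : ρ < ‖z‖) :
    GaussInterval ρ g s t ∧ ‖g s‖ * ρ ^ s = ‖z‖ * (‖f s‖ * ρ ^ s) := by
  have hM := h.pos hρ
  have key : ∀ i, ‖f i‖ * ρ ^ i = ‖f s‖ * ρ ^ s →
      ‖g i‖ * ρ ^ i = ‖z‖ * (‖f s‖ * ρ ^ s) := by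
    intro i hi
    rcases i with _ | i
    · rw [weight_zero h0, hi]
    · rw [weight_succ_right hρ (hg i), hi]
      rw [hi]
      exact (mul_le_mul_of_nonneg_left (h.le i) hρ.le).trans_lt (mul_lt_mul_of_pos_right hz hM)
  have key2 : ∀ i, ‖f i‖ * ρ ^ i < ‖f s‖ * ρ ^ s →
      ‖g i‖ * ρ ^ i < ‖z‖ * (‖f s‖ * ρ ^ s) := by
    intro i hi
    have hz0 := hρ.trans hz
    rcases i with _ | i
    · rw [weight_zero h0]; gcongr
    · refine (weight_succ_le hρ (hg i)).trans_lt (max_lt ?_ (by gcongr))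
      exact (mul_le_mul_of_nonneg_left (h.le i) hρ.le).trans_lt (mul_lt_mul_of_pos_right hz hM)
  refine ⟨.of_weights ⟨_, mul_pos (hρ.trans hz) hM, key s rfl, key t h.eq, fun i => ?_,
    fun i hi => key2 i (h.lt_left i hi), fun i hi => key2 i (h.lt_right i hi)⟩, key s rfl⟩
  rcases (h.le i).lt_or_eq with hi | hi
  · exact (key2 i hi).le
  · exact (key i hi).le

/-- Multiplication by a linear factor whose root is inside the circle. -/
theorem GaussInterval.linear_lt (hz : ‖z‖ < ρ) :
    GaussInterval ρ g (s + 1) (t + 1) ∧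
      ‖g (s + 1)‖ * ρ ^ (s + 1) = ρ * (‖f s‖ * ρ ^ s) := by
  have hM := h.pos hρ
  have aux : ∀ i, ‖z‖ * (‖f i‖ * ρ ^ i) < ρ * (‖f s‖ * ρ ^ s) := fun i =>
    (mul_le_mul_of_nonneg_left (h.le i) (norm_nonneg z)).trans_lt (mul_lt_mul_of_pos_right hz hM)
  have key : ∀ i, ‖f i‖ * ρ ^ i = ‖f s‖ * ρ ^ s →
      ‖g (i + 1)‖ * ρ ^ (i + 1) = ρ * (‖f s‖ * ρ ^ s) := by
    intro i hi
    rw [weight_succ_left hρ (hg i) (by rw [hi]; exact aux _), hi]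
  have key2 : ∀ i, ‖f i‖ * ρ ^ i < ‖f s‖ * ρ ^ s →
      ‖g (i + 1)‖ * ρ ^ (i + 1) < ρ * (‖f s‖ * ρ ^ s) := by
    intro i hi
    exact (weight_succ_le hρ (hg i)).trans_lt (max_lt (by gcongr) (aux _))
  have key0 : ‖g 0‖ * ρ ^ 0 < ρ * (‖f s‖ * ρ ^ s) := by rw [weight_zero h0]; exact aux 0
  refine ⟨.of_weights ⟨_, mul_pos hρ hM, key s rfl, key t h.eq, fun i => ?_, fun i hi => ?_,
    fun i hi => ?_⟩, key s rfl⟩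
  · rcases i with _ | i
    · exact key0.le
    rcases (h.le i).lt_or_eq with hi | hi
    · exact (key2 i hi).le
    · exact (key i hi).le
  · rcases i with _ | i
    · exact key0
    · exact key2 i (h.lt_left i (by omega))
  · rcases i with _ | i
    · omega
    · exact key2 i (h.lt_right i (by omega))

/-- Multiplication by a linear factor whose root is on the circle. -/
theorem GaussInterval.linear_eq (hz : ‖z‖ = ρ) :
    GaussInterval ρ g s (t + 1) ∧ ‖g s‖ * ρ ^ s = ρ * (‖f s‖ * ρ ^ s) := by
  have hM := h.pos hρ
  have key1 : ‖g s‖ * ρ ^ s = ρ * (‖f s‖ * ρ ^ s) := by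
    rcases s with _ | s
    · rw [weight_zero h0, hz]
    · rw [weight_succ_right hρ (hg s), hz]
      rw [hz]
      exact mul_lt_mul_of_pos_left (h.lt_left s (by omega)) hρ
  have key2 : ‖g (t + 1)‖ * ρ ^ (t + 1) = ρ * (‖f s‖ * ρ ^ s) := by
    rw [weight_succ_left hρ (hg t), h.eq]
    rw [h.eq, hz]
    exact mul_lt_mul_of_pos_left (h.lt_right (t + 1) (by omega)) hρ
  refine ⟨.of_weights ⟨_, mul_pos hρ hM, key1, key2, fun i => ?_, fun i hi => ?_,
    fun i hi => ?_⟩, key1⟩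
  · rcases i with _ | i
    · rw [weight_zero h0, hz]; exact mul_le_mul_of_nonneg_left (h.le 0) hρ.le
    · refine (weight_succ_le hρ (hg i)).trans (max_le ?_ ?_)
      · exact mul_le_mul_of_nonneg_left (h.le _) hρ.le
      · rw [hz]; exact mul_le_mul_of_nonneg_left (h.le _) hρ.le
  · rcases i with _ | i
    · rw [weight_zero h0, hz]; exact mul_lt_mul_of_pos_left (h.lt_left 0 hi) hρ
    · refine (weight_succ_le hρ (hg i)).trans_lt (max_lt ?_ ?_)
      · exact mul_lt_mul_of_pos_left (h.lt_left _ (by omega)) hρ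
      · rw [hz]; exact mul_lt_mul_of_pos_left (h.lt_left _ hi) hρ
  · rcases i with _ | i
    · omega
    · refine (weight_succ_le hρ (hg i)).trans_lt (max_lt ?_ ?_)
      · exact mul_lt_mul_of_pos_left (h.lt_right _ (by omega)) hρ
      · rw [hz]; exact mul_lt_mul_of_pos_left (h.lt_right _ (by omega)) hρ

end LinearFactor

/-! ### Roots of a polynomial on a circle. -/

section Polynomial

open Polynomial

variable {ρ : ℝ}

/-- Induction on the roots: a root inside the circle moves both extreme indices by one, a root on it
moves only the right one, a root outside moves none. Off the circle |x - z| is constant in x, so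
only the roots on the circle remain in the value. -/
theorem gaussInterval_prod_linear [DecidablePred fun z : 𝕜 => ‖z‖ = ρ] (hρ : 0 < ρ) {a : 𝕜}
    (ha : a ≠ 0) (m : Multiset 𝕜) :
    ∃ s t, GaussInterval ρ (C a * (m.map fun z => X - C z).prod).coeff s t ∧
      t = s + (m.filter fun z => ‖z‖ = ρ).card ∧
      ∀ x : 𝕜, ‖x‖ = ρ → ‖(C a * (m.map fun z => X - C z).prod).eval x‖ *
          ρ ^ (m.filter fun z => ‖z‖ = ρ).card =
        ‖(C a * (m.map fun z => X - C z).prod).coeff s‖ * ρ ^ s *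
          ((m.filter fun z => ‖z‖ = ρ).map fun z => ‖x - z‖).prod := by
  induction m using Multiset.induction_on with
  | empty =>
    refine ⟨0, 0, ⟨by simpa, rfl, fun i => ?_, by simp, fun i hi => ?_⟩, by simp, by simp⟩
    · rcases i with _ | i
      · exact le_rfl
      · simp [coeff_C]
    · rw [Multiset.map_zero, Multiset.prod_zero, mul_one, coeff_C_of_ne_zero (by omega)]
      simpa
  | cons z m ih =>
    obtain ⟨s, t, hGI, ht, hev⟩ := ih
    set P := C a * (m.map fun z => X - C z).prod with hP
    have hPz : C a * ((z ::ₘ m).map fun z => X - C z).prod = P * (X - C z) := by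
      rw [hP, Multiset.map_cons, Multiset.prod_cons]; ring
    rw [hPz]
    have h0 : (P * (X - C z)).coeff 0 = -(z * P.coeff 0) := by
      simp [mul_comm]
    have hs : ∀ i, (P * (X - C z)).coeff (i + 1) = P.coeff i - z * P.coeff (i + 1) := fun i => by
      rw [coeff_mul_X_sub_C, mul_comm z]
    rcases lt_trichotomy ‖z‖ ρ with hz | hz | hz
    · obtain ⟨h1, h2⟩ := hGI.linear_lt hρ h0 hs hz
      refine ⟨s + 1, t + 1, h1, ?_, fun x hx => ?_⟩
      · rw [Multiset.filter_cons_of_neg (p := fun z => ‖z‖ = ρ) _ hz.ne, ht]; ring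
      · rw [Multiset.filter_cons_of_neg (p := fun z => ‖z‖ = ρ) _ hz.ne, h2, mul_assoc ρ, ← hev x hx, eval_mul, norm_mul]
        have : ‖x - z‖ = ρ := by rw [norm_sub_eq_left_of_lt (by rwa [hx]), hx]
        simp only [eval_sub, eval_X, eval_C, this]; ring
    · obtain ⟨h1, h2⟩ := hGI.linear_eq hρ h0 hs hz
      refine ⟨s, t + 1, h1, ?_, fun x hx => ?_⟩
      · rw [Multiset.filter_cons_of_pos (p := fun z => ‖z‖ = ρ) _ hz, ht, Multiset.card_cons]; ring
      · rw [Multiset.filter_cons_of_pos (p := fun z => ‖z‖ = ρ) _ hz, h2, Multiset.card_cons, Multiset.map_cons,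
          Multiset.prod_cons, eval_mul, norm_mul]
        calc _ = ρ * ‖x - z‖ *
              (‖P.eval x‖ * ρ ^ (m.filter fun z => ‖z‖ = ρ).card) := by
              simp only [eval_sub, eval_X, eval_C]; ring
          _ = _ := by rw [hev x hx]; ring
    · obtain ⟨h1, h2⟩ := hGI.linear_gt hρ h0 hs hz
      refine ⟨s, t, h1, ?_, fun x hx => ?_⟩
      · rw [Multiset.filter_cons_of_neg (p := fun z => ‖z‖ = ρ) _ hz.ne', ht]
      · rw [Multiset.filter_cons_of_neg (p := fun z => ‖z‖ = ρ) _ hz.ne', h2, mul_assoc ‖z‖, ← hev x hx, eval_mul,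
          norm_mul]
        have : ‖x - z‖ = ‖z‖ := norm_sub_eq_right_of_lt (by rwa [hx])
        simp only [eval_sub, eval_X, eval_C, this]; ring

/-- A polynomial has `t - s` roots on the circle, where `s` and `t` are the extreme indices of its
dominant terms, and these roots determine its absolute value on the circle. -/
theorem GaussInterval.polynomial_roots [IsAlgClosed 𝕜] [DecidablePred fun z : 𝕜 => ‖z‖ = ρ]
    (hρ : 0 < ρ) {P : 𝕜[X]} {s t : ℕ} (h : GaussInterval ρ P.coeff s t) :
    (P.roots.filter fun z => ‖z‖ = ρ).card = t - s ∧
      ∀ x : 𝕜, ‖x‖ = ρ → ‖P.eval x‖ =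
        ‖P.coeff t‖ * ρ ^ s * ((P.roots.filter fun z => ‖z‖ = ρ).map fun z => ‖x - z‖).prod := by
  have hP : P ≠ 0 := fun h0 => h.ne_zero (by simp [h0])
  obtain ⟨s', t', h', ht, hev⟩ :=
    gaussInterval_prod_linear hρ (leadingCoeff_ne_zero.2 hP) P.roots
  rw [← (IsAlgClosed.splits P).eq_prod_roots] at h' hev
  obtain ⟨rfl, rfl⟩ := h.unique h'
  refine ⟨by omega, fun x hx => ?_⟩
  have h1 := hev x hx
  set d := (P.roots.filter fun z => ‖z‖ = ρ).card
  -- The extra factor ρ^d cancels, as the two extreme terms have equal weight and t = s + d.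
  refine mul_right_cancel₀ (pow_pos hρ d).ne' (h1.trans ?_)
  rw [← h.eq, ht]
  ring

end Polynomial

end GaussInterval

/-! ### Ultrametric power series on a circle. -/

section UltrametricSeries

open Filter Topology

variable {𝕜 : Type*} [NontriviallyNormedField 𝕜] [IsUltrametricDist 𝕜]

theorem norm_finset_sum_lt {ι : Type*} (S : Finset ι) {u : ι → 𝕜} {c : ℝ} (hc : 0 < c)
    (h : ∀ i ∈ S, ‖u i‖ < c) : ‖∑ i ∈ S, u i‖ < c := by
  classical
  induction S using Finset.induction_on with
  | empty => simpa
  | insert a S ha ih =>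
    rw [Finset.sum_insert ha]
    exact (IsUltrametricDist.norm_add_le_max _ _).trans_lt
      (max_lt (h a (by simp)) (ih fun i hi => h i (by simp [hi])))

/-- Strictness survives the infinite sum: all terms beyond some index are below c / 2, and the
finitely many others are each below c. -/
theorem norm_tsum_lt_of_tendsto {u : ℕ → 𝕜} (hu : Tendsto u atTop (𝓝 0)) {c : ℝ} (hc : 0 < c)
    (h : ∀ i, ‖u i‖ < c) : ‖∑' i, u i‖ < c := by
  obtain ⟨N, hN⟩ := (((tendsto_zero_iff_norm_tendsto_zero.1 hu).eventually_lt_const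
    (half_pos hc))).exists_forall_of_atTop
  by_cases hs : Summable u
  · rw [← hs.sum_add_tsum_nat_add N]
    refine (IsUltrametricDist.norm_add_le_max _ _).trans_lt
      (max_lt (norm_finset_sum_lt _ hc fun i _ => h i) ?_)
    exact (IsUltrametricDist.norm_tsum_le_of_forall_le_of_nonneg (half_pos hc).le
      fun i => (hN (i + N) (by omega)).le).trans_lt (half_lt_self hc)
  · rw [tsum_eq_zero_of_not_summable hs]; simpa

theorem norm_add_eq_left_of_lt {a b : 𝕜} (h : ‖b‖ < ‖a‖) : ‖a + b‖ = ‖a‖ := by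
  simpa using norm_sub_eq_left_of_lt (b := -b) (by simpa using h)

variable {ρ : ℝ} {f : ℕ → 𝕜} {s t : ℕ}

omit [IsUltrametricDist 𝕜] in
theorem tendsto_term (hf : Tendsto (fun i => ‖f i‖ * ρ ^ i) atTop (𝓝 0)) {x : 𝕜} (hx : ‖x‖ = ρ) :
    Tendsto (fun i => f i * x ^ i) atTop (𝓝 0) := by
  rw [tendsto_zero_iff_norm_tendsto_zero]
  simpa [hx] using hf

theorem GaussInterval.norm_tsum_of_eq (h : GaussInterval ρ f s s) (hρ : 0 < ρ)
    (hs : ∀ x : 𝕜, ‖x‖ = ρ → Summable fun i => f i * x ^ i) {x : 𝕜} (hx : ‖x‖ = ρ) :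
    ‖∑' i, f i * x ^ i‖ = ‖f s‖ * ρ ^ s := by
  have hn : ∀ i, ‖f i * x ^ i‖ = ‖f i‖ * ρ ^ i := fun i => by simp [hx]
  rw [(hs x hx).tsum_eq_add_tsum_ite s, ← hn s]
  refine norm_add_eq_left_of_lt (norm_tsum_lt_of_tendsto ?_ ?_ fun i => ?_)
  · refine ((hs x hx).tendsto_atTop_zero).congr' ?_
    filter_upwards [eventually_gt_atTop s] with i hi
    rw [if_neg hi.ne']
  · rw [hn]; exact h.pos hρ
  · split_ifs with hi
    · rw [norm_zero, hn]; exact h.pos hρ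
    · rw [hn, hn]
      rcases lt_or_gt_of_ne hi with hi | hi
      · exact h.lt_left i hi
      · exact h.lt_right i hi

/-! ### Division by X - z at a zero z. -/

section Division

variable [CompleteSpace 𝕜]

theorem summable_term (hf : Tendsto (fun i => ‖f i‖ * ρ ^ i) atTop (𝓝 0)) {x : 𝕜}
    (hx : ‖x‖ = ρ) : Summable fun i => f i * x ^ i :=
  NonarchimedeanAddGroup.summable_of_tendsto_cofinite_zero
    (by rw [Nat.cofinite_eq_atTop]; exact tendsto_term hf hx)

/-- The quotient of the power series with coefficients `f` by `X - z`, where `z` is a zero. -/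
noncomputable def divLinear (f : ℕ → 𝕜) (z : 𝕜) (j : ℕ) : 𝕜 := ∑' i, f (i + (j + 1)) * z ^ i

variable {z : 𝕜}

omit [CompleteSpace 𝕜] [IsUltrametricDist 𝕜] in
theorem pow_mul_divLinear (j : ℕ) :
    z ^ (j + 1) * divLinear f z j = ∑' i, f (i + (j + 1)) * z ^ (i + (j + 1)) := by
  rw [divLinear, ← tsum_mul_left]
  congr 1; ext i; ring

-- The weights of the quotient are, up to the factor ρ, the norms of the tails of the series at z.
-- This turns every estimate on the quotient into one on tails.
omit [CompleteSpace 𝕜] [IsUltrametricDist 𝕜] in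
theorem weight_divLinear (hz : ‖z‖ = ρ) (j : ℕ) :
    ρ * (‖divLinear f z j‖ * ρ ^ j) = ‖∑' i, f (i + (j + 1)) * z ^ (i + (j + 1))‖ := by
  rw [← pow_mul_divLinear, norm_mul, norm_pow, hz]; ring

variable (hρ : 0 < ρ) (hf : Tendsto (fun i => ‖f i‖ * ρ ^ i) atTop (𝓝 0)) (hz : ‖z‖ = ρ)
include hρ hf hz

omit hf [CompleteSpace 𝕜] [IsUltrametricDist 𝕜] in
theorem tendsto_divLinear :
    Tendsto (fun i => ‖divLinear f z i‖ * ρ ^ i) atTop (𝓝 0) := by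
  have h1 := (tendsto_sum_nat_add fun i => f i * z ^ i).norm
  have h2 := ((tendsto_add_atTop_iff_nat 1).2 h1).const_mul ρ⁻¹
  rw [norm_zero, mul_zero] at h2
  refine h2.congr fun j => ?_
  rw [← weight_divLinear hz, inv_mul_cancel_left₀ hρ.ne']

theorem divLinear_recurrence (j : ℕ) :
    divLinear f z j = f (j + 1) + z * divLinear f z (j + 1) := by
  have hz0 : z ≠ 0 := norm_pos_iff.1 (hz ▸ hρ)
  refine mul_left_cancel₀ (pow_ne_zero (j + 1) hz0) ?_
  rw [mul_add, ← mul_assoc, ← pow_succ, pow_mul_divLinear, pow_mul_divLinear]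
  have h := ((summable_nat_add_iff (j + 1)).2 (summable_term hf hz)).tsum_eq_zero_add
  rw [h, zero_add, mul_comm]
  congr 2; ext i; congr 2 <;> ring

theorem tsum_eq_linear_mul (h0 : ∑' i, f i * z ^ i = 0) {x : 𝕜} (hx : ‖x‖ = ρ) :
    ∑' i, f i * x ^ i = (x - z) * ∑' i, divLinear f z i * x ^ i := by
  have hd := summable_term (tendsto_divLinear (f := f) hρ hz) hx
  have hfz := summable_term hf hz
  have e0 : f 0 = - (z * divLinear f z 0) := by
    have h1 := hfz.tsum_eq_zero_add
    have h2 := pow_mul_divLinear (f := f) (z := z) 0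
    simp only [zero_add, pow_one] at h2
    rw [h0, ← h2] at h1
    linear_combination (norm := simp) -h1
  have e1 : ∀ i, f (i + 1) = divLinear f z i - z * divLinear f z (i + 1) := fun i => by
    rw [divLinear_recurrence hρ hf hz i]; ring
  rw [(summable_term hf hx).tsum_eq_zero_add, sub_mul, ← tsum_mul_left, ← tsum_mul_left,
    (hd.mul_left z).tsum_eq_zero_add, e0]
  have h3 : ∑' i, f (i + 1) * x ^ (i + 1) = (∑' i, x * (divLinear f z i * x ^ i)) -
      ∑' i, z * (divLinear f z (i + 1) * x ^ (i + 1)) := by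
    rw [← (hd.mul_left x).tsum_sub ((summable_nat_add_iff 1).2 (hd.mul_left z))]
    congr 1; ext i; rw [e1]; ring
  rw [h3]; ring

/-- Since the sum at z vanishes, a tail is minus the complementary head. Heads ending before s and
tails starting after t + 1 contain only small terms; the head ending at s and the tail starting at t
+ 1 each contain exactly one dominant term. Hence the right end drops by one. -/
theorem GaussInterval.divLinear (h : GaussInterval ρ f s (t + 1))
    (h0 : ∑' i, f i * z ^ i = 0) :
    GaussInterval ρ (divLinear f z) s t ∧ ‖_root_.divLinear f z t‖ = ‖f (t + 1)‖ := by
  have hM := h.pos hρ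
  set u : ℕ → 𝕜 := fun i => f i * z ^ i with hu
  have hun : ∀ i, ‖u i‖ = ‖f i‖ * ρ ^ i := fun i => by simp [hu, hz]
  have hus : Summable u := summable_term hf hz
  have hht : ∀ k, ‖∑' i, u (i + k)‖ = ‖∑ i ∈ Finset.range k, u i‖ := fun k => by
    have := hus.sum_add_tsum_nat_add k
    rw [h0] at this
    rw [eq_neg_of_add_eq_zero_right this, norm_neg]
  have htl : ∀ k, t + 1 < k → ‖∑' i, u (i + k)‖ < ‖f s‖ * ρ ^ s := fun k hk =>
    norm_tsum_lt_of_tendsto ((tendsto_add_atTop_iff_nat k).2 (tendsto_term hf hz)) hM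
      fun i => by rw [hun]; exact h.lt_right _ (by omega)
  have hhd : ∀ k, k ≤ s → ‖∑ i ∈ Finset.range k, u i‖ < ‖f s‖ * ρ ^ s := fun k hk =>
    norm_finset_sum_lt _ hM fun i hi => by
      rw [hun]; exact h.lt_left _ (by rw [Finset.mem_range] at hi; omega)
  have hs1 : ‖∑' i, u (i + (s + 1))‖ = ‖f s‖ * ρ ^ s := by
    rw [hht, Finset.sum_range_succ, add_comm, norm_add_eq_left_of_lt, hun]
    rw [hun]; exact hhd s le_rfl
  have ht1 : ‖∑' i, u (i + (t + 1))‖ = ‖f s‖ * ρ ^ s := by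
    have e := ((summable_nat_add_iff (t + 1)).2 hus).tsum_eq_zero_add
    have e2 : ∑' i, u (i + 1 + (t + 1)) = ∑' i, u (i + (t + 2)) := by
      congr 1; ext i; congr 1; ring
    have e3 : ‖u (0 + (t + 1))‖ = ‖f s‖ * ρ ^ s := by rw [zero_add, hun, h.eq]
    rw [e, e2, norm_add_eq_left_of_lt, e3]
    rw [e3]; exact htl _ (by omega)
  have hle : ∀ k, ‖∑' i, u (i + k)‖ ≤ ‖f s‖ * ρ ^ s := fun k =>
    IsUltrametricDist.norm_tsum_le_of_forall_le_of_nonneg hM.le fun i => by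
      rw [hun]; exact h.le _
  have hw : ∀ j, ‖_root_.divLinear f z j‖ * ρ ^ j = ρ⁻¹ * ‖∑' i, u (i + (j + 1))‖ := fun j => by
    rw [← weight_divLinear hz, inv_mul_cancel_left₀ hρ.ne']
  refine ⟨.of_weights ⟨ρ⁻¹ * (‖f s‖ * ρ ^ s), by positivity, by rw [hw, hs1], by rw [hw, ht1],
    fun i => ?_, fun i hi => ?_, fun i hi => ?_⟩, ?_⟩
  · rw [hw]; exact mul_le_mul_of_nonneg_left (hle _) (by positivity)
  · rw [hw, hht]; exact mul_lt_mul_of_pos_left (hhd _ (by omega)) (by positivity)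
  · rw [hw]; exact mul_lt_mul_of_pos_left (htl _ (by omega)) (by positivity)
  · have := hw t
    rw [ht1, ← h.eq] at this
    refine mul_right_cancel₀ (pow_pos hρ t).ne' (this.trans ?_)
    rw [inv_mul_eq_iff_eq_mul₀ hρ.ne']; ring

end Division

/-! ### Existence of zeros by truncation. -/

section Truncation

open Polynomial

/-- The polynomial of degree less than `N` with the coefficients `f`. -/
noncomputable def truncPoly (f : ℕ → 𝕜) (N : ℕ) : 𝕜[X] := ∑ i ∈ Finset.range N, monomial i (f i)

omit [IsUltrametricDist 𝕜] in
theorem coeff_truncPoly (N i : ℕ) : (truncPoly f N).coeff i = if i < N then f i else 0 := by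
  simp [truncPoly, coeff_monomial]

omit [IsUltrametricDist 𝕜] in
theorem eval_truncPoly (N : ℕ) (x : 𝕜) :
    (truncPoly f N).eval x = ∑ i ∈ Finset.range N, f i * x ^ i := by
  simp [truncPoly, eval_finsetSum]

omit [IsUltrametricDist 𝕜] in
theorem GaussInterval.truncPoly (h : GaussInterval ρ f s t) (hρ : 0 < ρ) {N : ℕ} (hN : t < N) :
    GaussInterval ρ (truncPoly f N).coeff s t := by
  have hs := h.index_le
  have hM := h.pos hρ
  have key : ∀ i, ‖(_root_.truncPoly f N).coeff i‖ * ρ ^ i ≤ ‖f i‖ * ρ ^ i := fun i => by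
    rw [coeff_truncPoly]; split_ifs
    · exact le_rfl
    · rw [norm_zero, zero_mul]; positivity
  have e : ∀ i ≤ t, (_root_.truncPoly f N).coeff i = f i := fun i hi => by
    rw [coeff_truncPoly, if_pos (by omega)]
  exact .of_weights ⟨_, hM, by rw [e s hs], by rw [e t le_rfl, h.eq], fun i => (key i).trans (h.le i),
    fun i hi => (key i).trans_lt (h.lt_left i hi), fun i hi => (key i).trans_lt (h.lt_right i hi)⟩

theorem norm_eval_truncPoly_sub_le {ε : ℝ} (hε : 0 ≤ ε) {M : ℕ}
    (hM : ∀ i ≥ M, ‖f i‖ * ρ ^ i ≤ ε) {N N' : ℕ} (hN : M ≤ N) (hN' : M ≤ N') {x : 𝕜}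
    (hx : ‖x‖ = ρ) : ‖(truncPoly f N).eval x - (truncPoly f N').eval x‖ ≤ ε := by
  wlog hNN : N' ≤ N generalizing N N'
  · rw [norm_sub_rev]; exact this hN' hN (by omega)
  rw [eval_truncPoly, eval_truncPoly, ← Finset.sum_Ico_eq_sub _ hNN]
  refine IsUltrametricDist.norm_sum_le_of_forall_le_of_nonneg hε fun i hi => ?_
  rw [norm_mul, norm_pow, hx]
  exact hM i (by rw [Finset.mem_Ico] at hi; omega)

theorem norm_tsum_sub_eval_truncPoly_le [CompleteSpace 𝕜]
    (hf : Tendsto (fun i => ‖f i‖ * ρ ^ i) atTop (𝓝 0)) {ε : ℝ} (hε : 0 ≤ ε)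
    {M : ℕ} (hM : ∀ i ≥ M, ‖f i‖ * ρ ^ i ≤ ε) {N : ℕ} (hN : M ≤ N) {x : 𝕜}
    (hx : ‖x‖ = ρ) : ‖∑' i, f i * x ^ i - (truncPoly f N).eval x‖ ≤ ε := by
  rw [eval_truncPoly, ← (summable_term hf hx).sum_add_tsum_nat_add N, add_sub_cancel_left]
  refine IsUltrametricDist.norm_tsum_le_of_forall_le_of_nonneg hε fun i => ?_
  rw [norm_mul, norm_pow, hx]
  exact hM _ (by omega)

omit [IsUltrametricDist 𝕜] in
theorem Multiset.pow_card_le_prod_map {α : Type*} (m : Multiset α) {g : α → ℝ} {c : ℝ}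
    (hc : 0 ≤ c) (h : ∀ a ∈ m, c ≤ g a) : c ^ m.card ≤ (m.map g).prod := by
  induction m using Multiset.induction_on with
  | empty => simp
  | cons a m ih =>
    rw [Multiset.card_cons, Multiset.map_cons, Multiset.prod_cons, pow_succ']
    exact mul_le_mul (h a (by simp)) (ih fun b hb => h b (by simp [hb])) (by positivity)
      (hc.trans (h a (by simp)))

/-- Dependent choice, used to build a Cauchy sequence of roots of truncations. -/
theorem exists_seq_of_step {α : Type*} {R : ℕ → α → Prop} {Q : ℕ → α → α → Prop}
    (h0 : ∃ a, R 0 a) (hs : ∀ k a, R k a → ∃ b, R (k + 1) b ∧ Q k a b) :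
    ∃ a : ℕ → α, (∀ k, R k (a k)) ∧ ∀ k, Q k (a k) (a (k + 1)) := by
  obtain ⟨a0, ha0⟩ := h0
  have : Nonempty α := ⟨a0⟩
  choose! g hg hQ using hs
  let a : ℕ → α := fun n => Nat.rec a0 g n
  have ha : ∀ k, R k (a k) := fun k => by
    induction k with
    | zero => exact ha0
    | succ k ih => exact hg k _ ih
  exact ⟨a, ha, fun k => hQ k _ (ha k)⟩

variable [CompleteSpace 𝕜] [IsAlgClosed 𝕜]

/-- A power series with several dominant terms on a circle has a zero on it. -/
theorem GaussInterval.exists_zero (h : GaussInterval ρ f s t) (hst : s < t) (hρ : 0 < ρ)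
    (hf : Tendsto (fun i => ‖f i‖ * ρ ^ i) atTop (𝓝 0)) :
    ∃ z : 𝕜, ‖z‖ = ρ ∧ ∑' i, f i * z ^ i = 0 := by
  classical
  have hsmall : ∀ ε > 0, ∃ M, ∀ i ≥ M, ‖f i‖ * ρ ^ i ≤ ε := fun ε hε =>
    ((hf.eventually_lt_const hε).mono fun _ h => h.le).exists_forall_of_atTop
  set c := ‖f t‖ * ρ ^ s
  have hc : 0 < c := by
    have h1 : 0 < ‖f t‖ * ρ ^ t := h.eq ▸ h.pos hρ
    exact mul_pos (pos_of_mul_pos_left h1 (by positivity)) (pow_pos hρ s)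
  -- If all t - s roots were farther than 2^(-k) from z, the value at z would be at least c
  -- (2^(-k))^(t - s); the final division by 2 makes the contradiction strict.
  have hδ : ∀ k : ℕ, 0 < c * ((1 / 2 : ℝ) ^ k) ^ (t - s) / 2 := fun k => by positivity
  choose M hM using fun k => hsmall _ (hδ k)
  -- `N k` exceeds t, tends to infinity, and dominates every `M j` with j ≤ k.
  set N : ℕ → ℕ := fun k => t + 1 + k + ∑ j ∈ Finset.range (k + 1), M j with hN
  have hMN : ∀ j k, j ≤ k → M j ≤ N k := fun j k hjk =>
    (Finset.single_le_sum (f := M) (fun _ _ => Nat.zero_le _)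
      (Finset.mem_range.2 (by omega : j < k + 1))).trans (Nat.le_add_left _ _)
  have hroots : ∀ k, ((_root_.truncPoly f (N k)).roots.filter fun z => ‖z‖ = ρ).card = t - s ∧
      ∀ x : 𝕜, ‖x‖ = ρ → ‖(_root_.truncPoly f (N k)).eval x‖ = c *
        (((_root_.truncPoly f (N k)).roots.filter fun z => ‖z‖ = ρ).map fun z => ‖x - z‖).prod := by
    intro k
    have hk : t < N k := by simp only [hN]; omega
    obtain ⟨h1, h2⟩ := (h.truncPoly hρ hk).polynomial_roots hρ
    refine ⟨h1, fun x hx => ?_⟩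
    rw [h2 x hx, coeff_truncPoly, if_pos hk]
  -- A root of one truncation makes the next truncation small there, so the next one has a root
  -- within 2^(-k).
  obtain ⟨z, hz, hzz⟩ := exists_seq_of_step
    (R := fun k z => ‖z‖ = ρ ∧ (_root_.truncPoly f (N k)).eval z = 0)
    (Q := fun k z z' => dist z z' ≤ 1 * (1 / 2 : ℝ) ^ k) (by
      obtain ⟨z, hz⟩ := Multiset.card_pos_iff_exists_mem.1
        ((Nat.sub_pos_of_lt hst).trans_eq (hroots 0).1.symm)
      rw [Multiset.mem_filter] at hz
      exact ⟨z, hz.2, (mem_roots'.1 hz.1).2⟩) (by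
      rintro k z ⟨hz, hz0⟩
      by_contra! hcon
      have h1 : ‖(_root_.truncPoly f (N (k + 1))).eval z‖ ≤
          c * ((1 / 2 : ℝ) ^ k) ^ (t - s) / 2 := by
        have := norm_eval_truncPoly_sub_le (hδ k).le (hM k) (hMN k (k + 1) (by omega))
          (hMN k k le_rfl) hz
        rwa [hz0, sub_zero] at this
      rw [(hroots (k + 1)).2 z hz] at h1
      have h2 := Multiset.pow_card_le_prod_map
        ((_root_.truncPoly f (N (k + 1))).roots.filter fun z => ‖z‖ = ρ)
        (g := fun z' => ‖z - z'‖) (c := (1 / 2 : ℝ) ^ k) (by positivity) (fun z' hz' => by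
          rw [Multiset.mem_filter] at hz'
          have := hcon z' ⟨hz'.2, (mem_roots'.1 hz'.1).2⟩
          rw [one_mul, dist_eq_norm] at this
          exact this.le)
      rw [(hroots (k + 1)).1] at h2
      have h3 := mul_le_mul_of_nonneg_left h2 hc.le
      have := hδ k
      linarith)
  obtain ⟨w, hw⟩ := cauchySeq_tendsto_of_complete
    (cauchySeq_of_le_geometric (1 / 2) 1 (by norm_num) hzz)
  have hwρ : ‖w‖ = ρ := tendsto_nhds_unique hw.norm (by simp [fun k => (hz k).1])
  refine ⟨w, hwρ, ?_⟩
  rw [← norm_le_zero_iff]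
  refine le_of_forall_pos_le_add fun ε hε => ?_
  rw [zero_add]
  obtain ⟨L, hL⟩ := hsmall ε hε
  refine le_of_tendsto (summable_term hf hwρ).hasSum.tendsto_sum_nat.norm ?_
  filter_upwards [eventually_ge_atTop L] with n hn
  rw [← eval_truncPoly]
  refine le_of_tendsto ((((_root_.truncPoly f n).continuous.tendsto w).comp hw).norm) ?_
  filter_upwards [eventually_ge_atTop L] with k hk
  have := norm_eval_truncPoly_sub_le hε.le hL hn
    (show L ≤ N k by simp only [hN]; omega) (hz k).1
  rwa [(hz k).2, sub_zero] at this

/-- The zeros of a power series on a circle, split off as linear factors. -/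
theorem GaussInterval.exists_factorization (hρ : 0 < ρ) (d : ℕ) (h : GaussInterval ρ f s (s + d))
    (hf : Tendsto (fun i => ‖f i‖ * ρ ^ i) atTop (𝓝 0)) :
    ∃ (Z : Multiset 𝕜) (u : ℕ → 𝕜), Z.card = d ∧ (∀ z ∈ Z, ‖z‖ = ρ) ∧
      GaussInterval ρ u s s ∧ ‖u s‖ = ‖f (s + d)‖ ∧
      Tendsto (fun i => ‖u i‖ * ρ ^ i) atTop (𝓝 0) ∧
      ∀ x : 𝕜, ‖x‖ = ρ →
        ∑' i, f i * x ^ i = (Z.map fun z => x - z).prod * ∑' i, u i * x ^ i := by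
  induction d generalizing f with
  | zero => exact ⟨0, f, rfl, by simp, h, rfl, hf, by simp⟩
  | succ d ih =>
    obtain ⟨z, hz, h0⟩ := h.exists_zero (by omega) hρ hf
    obtain ⟨h1, h2⟩ := GaussInterval.divLinear hρ hf hz (t := s + d) h h0
    obtain ⟨Z, u, hZ, hZρ, hu, hus, hu0, hev⟩ := ih h1 (tendsto_divLinear hρ hz)
    refine ⟨z ::ₘ Z, u, by rw [Multiset.card_cons, hZ], ?_, hu, hus.trans h2, hu0, fun x hx => ?_⟩
    · intro w hw
      rcases Multiset.mem_cons.1 hw with rfl | hw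
      · exact hz
      · exact hZρ w hw
    · rw [tsum_eq_linear_mul hρ hf hz h0 hx, hev x hx, Multiset.map_cons, Multiset.prod_cons,
        mul_assoc]

end Truncation

/-! ### Analyticity on the circle, needed to compute multiplicities. -/

section Analytic

variable [CompleteSpace 𝕜]

/-- Expand (z + y)^i by the binomial theorem and sum the double family by columns. Binomial
coefficients have norm at most 1, so each term of row i is bounded by the weight of `f i`, and the
family is summable. The truncated exponent i - n is harmless, as the binomial coefficient vanishes
for i < n. -/
theorem analyticAt_tsum (hρ : 0 < ρ) (hf : Tendsto (fun i => ‖f i‖ * ρ ^ i) atTop (𝓝 0)) {z : 𝕜}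
    (hz : ‖z‖ = ρ) : AnalyticAt 𝕜 (fun x => ∑' i, f i * x ^ i) z := by
  refine ⟨FormalMultilinearSeries.ofScalars 𝕜
    fun n => ∑' i, f i * (z ^ (i - n) * (i.choose n : 𝕜)), ?_⟩
  rw [hasFPowerSeriesAt_iff]
  filter_upwards [Metric.ball_mem_nhds (0 : 𝕜) hρ] with y hy
  rw [mem_ball_zero_iff] at hy
  have hyz : ‖z + y‖ = ρ := by rw [norm_add_eq_left_of_lt (by rwa [hz]), hz]
  let a : ℕ × ℕ → 𝕜 := fun q => f q.1 * (y ^ q.2 * z ^ (q.1 - q.2) * (q.1.choose q.2 : 𝕜))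
  have hzero : ∀ i n, i < n → a (i, n) = 0 := fun i n hin => by
    simp [a, Nat.choose_eq_zero_of_lt hin]
  have hle : ∀ i n, ‖a (i, n)‖ ≤ ‖f i‖ * ρ ^ i := fun i n => by
    rcases le_or_gt n i with hn | hn
    · simp only [a, norm_mul, norm_pow, hz]
      have h1 : ‖((i.choose n : ℕ) : 𝕜)‖ ≤ 1 := IsUltrametricDist.norm_natCast_le_one 𝕜 _
      calc _ ≤ ‖f i‖ * (ρ ^ n * ρ ^ (i - n) * 1) := by gcongr
        _ = _ := by rw [mul_one, ← pow_add, Nat.add_sub_cancel' hn]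
    · rw [hzero i n hn, norm_zero]; positivity
  have hsum : Summable a := by
    refine NonarchimedeanAddGroup.summable_of_tendsto_cofinite_zero ?_
    rw [Metric.tendsto_nhds]
    intro ε hε
    obtain ⟨N, hN⟩ := (hf.eventually_lt_const hε).exists_forall_of_atTop
    rw [eventually_cofinite]
    refine ((Finset.range N ×ˢ Finset.range N).finite_toSet).subset ?_
    rintro ⟨i, n⟩ hin
    simp only [Set.mem_ofPred_eq, dist_zero_right, not_lt] at hin
    have h1 : i < N := by
      by_contra! hi
      exact absurd ((hle i n).trans_lt (hN i hi)) (not_lt.2 hin)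
    have h2 : n ≤ i := by
      by_contra! hn
      rw [hzero i n hn, norm_zero] at hin
      linarith
    simp only [Finset.coe_product, Finset.coe_range, Set.mem_prod, Set.mem_Iio]
    omega
  have hrow : ∀ i, HasSum (fun n => a (i, n)) (f i * (z + y) ^ i) := fun i => by
    have h1 : f i * (z + y) ^ i = ∑ n ∈ Finset.range (i + 1), a (i, n) := by
      rw [add_comm z y, add_pow, Finset.mul_sum]
    rw [h1]
    exact hasSum_sum_of_ne_finset_zero fun n hn => hzero i n (by simpa using hn)
  have htot : HasSum a (∑' i, f i * (z + y) ^ i) := by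
    have h1 := hsum.hasSum.prod_fiberwise hrow
    rw [h1.tsum_eq]; exact hsum.hasSum
  have hcol : ∀ n, HasSum (fun i => a (i, n))
      (y ^ n * ∑' i, f i * (z ^ (i - n) * (i.choose n : 𝕜))) := fun n => by
    have h1 : Summable fun i => a (i, n) := hsum.prod_symm.prod_factor n
    have h2 : y ^ n * ∑' i, f i * (z ^ (i - n) * (i.choose n : 𝕜)) = ∑' i, a (i, n) := by
      rw [← tsum_mul_left]; congr 1; ext i; simp only [a]; ring
    rw [h2]; exact h1.hasSum
  have h3 := ((Equiv.prodComm ℕ ℕ).hasSum_iff.2 htot).prod_fiberwise hcol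
  simpa [FormalMultilinearSeries.coeff_ofScalars] using h3

end Analytic

end UltrametricSeries

/-! ### From characteristic sequences to dominant terms. -/

section CharacteristicSequence

open Filter Topology

variable {p : ℕ} [hp : Fact p.Prime]

theorem one_lt_cast_prime : (1 : ℝ) < p := mod_cast hp.out.one_lt

theorem vp_of_ne_zero {x : ℂ_[p]} (hx : x ≠ 0) :
    vp x = ((-Real.logb (p : ℝ) ‖x‖ : ℝ) : EReal) := by rw [vp, if_neg hx]

@[simp] theorem vp_zero : vp (0 : ℂ_[p]) = ⊤ := by rw [vp, if_pos rfl]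

theorem vp_eq_coe_iff {x : ℂ_[p]} {α : ℝ} : vp x = (α : EReal) ↔ ‖x‖ = (p : ℝ) ^ (-α) := by
  have h1 := one_lt_cast_prime (p := p)
  rcases eq_or_ne x 0 with rfl | hx
  · have : (0 : ℝ) < (p : ℝ) ^ (-α) := Real.rpow_pos_of_pos (by linarith) _
    simp [this.ne]
  · rw [vp_of_ne_zero hx, EReal.coe_eq_coe_iff, neg_eq_iff_eq_neg,
      Real.logb_eq_iff_rpow_eq (by linarith) h1.ne' (norm_pos_iff.2 hx), eq_comm]

theorem mem_circleC_iff {x : ℂ_[p]} {α : ℝ} :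
    x ∈ circleC p (α : EReal) ↔ ‖x‖ = (p : ℝ) ^ (-α) := vp_eq_coe_iff

variable {F : PowerSeries ℂ_[p]} {i j : ℕ}

theorem quot_of_coeff_eq_zero (hj : PowerSeries.coeff j F ≠ 0) (hji : j < i)
    (hi : PowerSeries.coeff i F = 0) : quot F j i = ⊥ := by
  have h : (0 : ℝ) < (i : ℝ) - j := sub_pos.2 (mod_cast hji)
  rw [quot, hi, vp_zero, vp_of_ne_zero hj, EReal.sub_top,
    EReal.bot_div_of_pos_ne_top (by exact_mod_cast h) (EReal.coe_ne_top _)]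

theorem quot_of_coeff_ne_zero (hj : PowerSeries.coeff j F ≠ 0)
    (hi : PowerSeries.coeff i F ≠ 0) : quot F j i =
      (((Real.logb p ‖PowerSeries.coeff i F‖ - Real.logb p ‖PowerSeries.coeff j F‖) /
        ((i : ℝ) - j) : ℝ) : EReal) := by
  rw [quot, vp_of_ne_zero hj, vp_of_ne_zero hi, ← EReal.coe_sub, ← EReal.coe_div]
  congr 2; ring

theorem logb_weight {x : ℂ_[p]} (hx : x ≠ 0) (α : ℝ) (i : ℕ) :
    Real.logb p (‖x‖ * ((p : ℝ) ^ (-α)) ^ i) = Real.logb p ‖x‖ - i * α := by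
  have h1 := one_lt_cast_prime (p := p)
  have h0 : (0 : ℝ) < p := by linarith
  rw [Real.logb_mul (norm_ne_zero_iff.2 hx) (pow_pos (Real.rpow_pos_of_pos h0 _) _).ne',
    Real.logb_pow, Real.logb_rpow h0 h1.ne']
  ring

/-- Taking logarithms turns the comparison of two terms on the circle into a comparison of a slope
with α. -/
theorem weight_lt_iff (hj : PowerSeries.coeff j F ≠ 0) (hji : j < i) (α : ℝ) :
    ‖PowerSeries.coeff i F‖ * ((p : ℝ) ^ (-α)) ^ i < ‖PowerSeries.coeff j F‖ * ((p : ℝ) ^ (-α)) ^ j ↔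
      quot F j i < α := by
  have h1 := one_lt_cast_prime (p := p)
  have h0 : (0 : ℝ) < (p : ℝ) ^ (-α) := Real.rpow_pos_of_pos (by linarith) _
  have h : (0 : ℝ) < (i : ℝ) - j := sub_pos.2 (mod_cast hji)
  have hjp := norm_pos_iff.2 hj
  by_cases hi : PowerSeries.coeff i F = 0
  · rw [quot_of_coeff_eq_zero hj hji hi, hi, norm_zero, zero_mul]
    exact iff_of_true (by positivity) (EReal.bot_lt_coe α)
  · have hip := norm_pos_iff.2 hi
    rw [quot_of_coeff_ne_zero hj hi, EReal.coe_lt_coe_iff, div_lt_iff₀ h,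
      ← Real.logb_lt_logb_iff h1 (by positivity) (by positivity), logb_weight hi, logb_weight hj]
    constructor <;> intro _ <;> linarith

theorem weight_le_iff (hj : PowerSeries.coeff j F ≠ 0) (hji : j < i) (α : ℝ) :
    ‖PowerSeries.coeff i F‖ * ((p : ℝ) ^ (-α)) ^ i ≤ ‖PowerSeries.coeff j F‖ * ((p : ℝ) ^ (-α)) ^ j ↔
      quot F j i ≤ α := by
  have h1 := one_lt_cast_prime (p := p)
  have h0 : (0 : ℝ) < (p : ℝ) ^ (-α) := Real.rpow_pos_of_pos (by linarith) _
  have h : (0 : ℝ) < (i : ℝ) - j := sub_pos.2 (mod_cast hji)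
  have hjp := norm_pos_iff.2 hj
  by_cases hi : PowerSeries.coeff i F = 0
  · rw [quot_of_coeff_eq_zero hj hji hi, hi, norm_zero, zero_mul]
    exact iff_of_true (by positivity) bot_le
  · have hip := norm_pos_iff.2 hi
    rw [quot_of_coeff_ne_zero hj hi, EReal.coe_le_coe_iff, div_le_iff₀ h,
      ← Real.logb_le_logb h1 (by positivity) (by positivity), logb_weight hi, logb_weight hj]
    constructor <;> intro _ <;> linarith

theorem IsNextIndex.coeff_ne_zero {k : ℕ} (h : IsNextIndex F j k)
    (hj : PowerSeries.coeff j F ≠ 0) : PowerSeries.coeff k F ≠ 0 := by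
  intro hk
  obtain ⟨⟨hjk, hmax⟩, hub⟩ := h
  rw [quot_of_coeff_eq_zero hj hjk hk] at hmax
  have : k + 1 ≤ k := hub ⟨by omega, fun i' hi' => (hmax i' hi').trans bot_le⟩
  omega

theorem IsNextIndex.quot_lt {k : ℕ} (h : IsNextIndex F j k) (hi : k < i) :
    quot F j i < quot F j k := by
  obtain ⟨⟨hjk, hmax⟩, hub⟩ := h
  refine lt_of_le_of_ne (hmax i (by omega)) fun e => ?_
  have : i ≤ k := hub ⟨by omega, fun i' hi' => e ▸ hmax i' hi'⟩
  omega

/-- On the circle attached to the term `k (n + 1)` of the characteristic sequence, the dominant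
terms of the series lie between the indices `k n` and `k (n + 1)`. -/
theorem IsCharSeq.gaussInterval {k : ℕ → ℕ} {N : ℕ} (h : IsCharSeq F k N) (n : ℕ) (hn : n < N) :
    ∃ α : ℝ, quot F (k n) (k (n + 1)) = α ∧
      GaussInterval ((p : ℝ) ^ (-α)) (fun i => PowerSeries.coeff i F) (k n) (k (n + 1)) := by
  have h1 := one_lt_cast_prime (p := p)
  have h0 : (0 : ℝ) < p := by linarith
  -- The maximality in `IsNextIndex` controls all indices above `k n`; only those below it remain.
  have key : ∀ n < N, PowerSeries.coeff (k n) F ≠ 0 → (∀ α : ℝ, quot F (k n) (k (n + 1)) = α →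
      ∀ i < k n, ‖PowerSeries.coeff i F‖ * ((p : ℝ) ^ (-α)) ^ i <
        ‖PowerSeries.coeff (k n) F‖ * ((p : ℝ) ^ (-α)) ^ (k n)) →
      ∃ α : ℝ, quot F (k n) (k (n + 1)) = α ∧
        GaussInterval ((p : ℝ) ^ (-α)) (fun i => PowerSeries.coeff i F) (k n) (k (n + 1)) := by
    intro n hn hne hleft
    have hnext := h.2 n hn
    have hlt : k n < k (n + 1) := hnext.1.1
    obtain ⟨α, hα⟩ : ∃ α : ℝ, quot F (k n) (k (n + 1)) = α :=
      ⟨_, quot_of_coeff_ne_zero hne (hnext.coeff_ne_zero hne)⟩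
    refine ⟨α, hα, hne, le_antisymm ((weight_le_iff hne hlt α).2 hα.le) ?_, fun i => ?_,
      hleft α hα, fun i hi => (weight_lt_iff hne (hlt.trans hi) α).2 (hα ▸ hnext.quot_lt hi)⟩
    · by_contra! hcon
      exact ((weight_lt_iff hne hlt α).1 hcon).ne hα
    · rcases lt_trichotomy i (k n) with hi | rfl | hi
      · exact (hleft α hα i hi).le
      · exact le_rfl
      · exact (weight_le_iff hne hi α).2 (hα ▸ hnext.1.2 i hi)
  induction n with
  | zero =>
    refine key 0 hn h.1.1 fun α _ i hi => ?_
    have hi0 : PowerSeries.coeff i F = 0 := by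
      by_contra hne
      exact absurd (h.1.2 hne) (by omega)
    have := norm_pos_iff.2 h.1.1
    have := Real.rpow_pos_of_pos h0 (-α)
    rw [hi0, norm_zero, zero_mul]; positivity
  | succ n ih =>
    obtain ⟨α, hα, hGI⟩ := ih (by omega)
    have hne : PowerSeries.coeff (k (n + 1)) F ≠ 0 := (h.2 n (by omega)).coeff_ne_zero hGI.ne_zero
    refine key (n + 1) hn hne fun α' hα' i hi => ?_
    have hlt : k (n + 1) < k (n + 2) := (h.2 (n + 1) hn).1.1
    have h2 := hGI.lt_right _ hlt
    rw [← hGI.eq] at h2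
    -- The slopes strictly decrease, so the radius grows; passing from ρ to ρ' multiplies the weight
    -- of index i by (ρ'/ρ)^i, which favours `k (n + 1)` over every smaller index.
    rw [weight_lt_iff hne hlt, hα', EReal.coe_lt_coe_iff] at h2
    have hρ := Real.rpow_pos_of_pos h0 (-α)
    have hρ' := Real.rpow_pos_of_pos h0 (-α')
    have hρρ : (p : ℝ) ^ (-α) < (p : ℝ) ^ (-α') := Real.rpow_lt_rpow_of_exponent_lt h1 (by linarith)
    set ρ := (p : ℝ) ^ (-α)
    set ρ' := (p : ℝ) ^ (-α')
    have h3 : 1 < ρ' / ρ := (one_lt_div hρ).2 hρρ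
    have e : ∀ m : ℕ, ρ' ^ m = ρ ^ m * (ρ' / ρ) ^ m := fun m => by
      rw [← mul_pow, mul_div_cancel₀ _ hρ.ne']
    have hM : 0 < ‖PowerSeries.coeff (k (n + 1)) F‖ * ρ ^ k (n + 1) := by
      have := norm_pos_iff.2 hne
      positivity
    rw [e i, e (k (n + 1)), ← mul_assoc, ← mul_assoc]
    calc _ ≤ ‖PowerSeries.coeff (k (n + 1)) F‖ * ρ ^ k (n + 1) * (ρ' / ρ) ^ i := by
          have := hGI.le i
          rw [← hGI.eq] at this
          gcongr
      _ < _ := by gcongr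

theorem tendsto_weight_of_convergesAt {x : ℂ_[p]} (h : ConvergesAt F x) :
    Tendsto (fun i => ‖PowerSeries.coeff i F‖ * ‖x‖ ^ i) atTop (𝓝 0) := by
  simpa using (Summable.tendsto_atTop_zero h).norm

end CharacteristicSequence

/-! ### The distinguished polynomial of a circle. -/

section CirclePolynomial

open Filter Topology

theorem norm_prod_map {ι 𝕜 : Type*} [NormedField 𝕜] (m : Multiset ι) (g : ι → 𝕜) :
    ‖(m.map g).prod‖ = (m.map fun i => ‖g i‖).prod := by
  induction m using Multiset.induction_on with
  | empty => simp
  | cons a m ih => simp [ih]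

theorem analyticOrderAt_prod_sub {𝕜 : Type*} [NontriviallyNormedField 𝕜] [DecidableEq 𝕜]
    (Z : Multiset 𝕜) (z : 𝕜) :
    AnalyticAt 𝕜 (fun x => (Z.map fun w => x - w).prod) z ∧
      analyticOrderAt (fun x => (Z.map fun w => x - w).prod) z = Z.count z := by
  induction Z using Multiset.induction_on with
  | empty =>
    refine ⟨by simpa using analyticAt_const, ?_⟩
    rw [AnalyticAt.analyticOrderAt_eq_zero (by simpa using analyticAt_const) |>.2 (by simp)]
    simp
  | cons w Z ih =>
    have e : (fun x => ((w ::ₘ Z).map fun w => x - w).prod) =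
        (fun x => x - w) * fun x => (Z.map fun w => x - w).prod := by
      ext x; simp
    have h1 : AnalyticAt 𝕜 (fun x : 𝕜 => x - w) z := analyticAt_id.sub analyticAt_const
    rw [e]
    refine ⟨h1.mul ih.1, ?_⟩
    rw [analyticOrderAt_mul h1 ih.1, ih.2, Multiset.count_cons]
    by_cases hzw : z = w
    · subst hzw
      have : analyticOrderAt (fun x : 𝕜 => x - z) z = 1 := analyticOrderAt_id_sub_const_self
      rw [this, if_pos rfl]; push_cast; ring
    · have : analyticOrderAt (fun x : 𝕜 => x - w) z = 0 := analyticOrderAt_id_sub_const_of_ne hzw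
      rw [this, if_neg hzw]; simp

variable {p : ℕ} [hp : Fact p.Prime] {F : PowerSeries ℂ_[p]} {s t : ℕ} {α : ℝ}

open Polynomial in
/-- The distinguished polynomial of a power series in a circle: its roots, and the absolute value
of the series on the circle. -/
theorem GaussInterval.circlePoly
    (h : GaussInterval ((p : ℝ) ^ (-α)) (fun i => PowerSeries.coeff i F) s t)
    (hF : Tendsto (fun i => ‖PowerSeries.coeff i F‖ * ((p : ℝ) ^ (-α)) ^ i) atTop (𝓝 0)) :
    ∃ Z : Multiset ℂ_[p], Z.card = t - s ∧ (∀ z ∈ Z, ‖z‖ = (p : ℝ) ^ (-α)) ∧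
      circlePoly F α = (Z.map fun z => X - C z).prod ∧
      ∀ x : ℂ_[p], ‖x‖ = (p : ℝ) ^ (-α) → ‖psEval F x‖ =
        ‖PowerSeries.coeff t F‖ * ((p : ℝ) ^ (-α)) ^ s * (Z.map fun z => ‖x - z‖).prod := by
  classical
  have h1 := one_lt_cast_prime (p := p)
  have hρ : (0 : ℝ) < (p : ℝ) ^ (-α) := Real.rpow_pos_of_pos (by linarith) _
  obtain ⟨d, rfl⟩ := Nat.exists_eq_add_of_le h.index_le
  obtain ⟨Z, u, hZ, hZρ, hu, hus, hu0, hev⟩ := h.exists_factorization hρ d hF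
  set ρ := (p : ℝ) ^ (-α) with hρdef
  have hun : ∀ x : ℂ_[p], ‖x‖ = ρ →
      ‖∑' i, u i * x ^ i‖ = ‖PowerSeries.coeff (s + d) F‖ * ρ ^ s := fun x hx => by
    rw [hu.norm_tsum_of_eq hρ (fun x hx => summable_term hu0 hx) hx, hus]
  have hc : 0 < ‖PowerSeries.coeff (s + d) F‖ * ρ ^ s := by
    rw [← hus]; exact hu.pos hρ
  have hu_ne : ∀ x : ℂ_[p], ‖x‖ = ρ → ∑' i, u i * x ^ i ≠ 0 := fun x hx =>
    norm_pos_iff.1 (hun x hx ▸ hc)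
  have hev' : ∀ x : ℂ_[p], ‖x‖ = ρ → psEval F x =
      (Z.map fun z => x - z).prod * ∑' i, u i * x ^ i := hev
  refine ⟨Z, by omega, hZρ, ?_, fun x hx => ?_⟩
  · have hset : {z : ℂ_[p] | z ∈ circleC p (α : EReal) ∧ psEval F z = 0} = ↑Z.toFinset := by
      ext z
      simp only [Set.mem_ofPred_eq, mem_circleC_iff, Finset.mem_coe, Multiset.mem_toFinset]
      constructor
      · rintro ⟨hz, hz0⟩
        rw [hev' z hz, mul_eq_zero, or_iff_left (hu_ne z hz), Multiset.prod_eq_zero_iff,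
          Multiset.mem_map] at hz0
        obtain ⟨w, hw, hwz⟩ := hz0
        rwa [sub_eq_zero.1 hwz]
      · intro hz
        refine ⟨hZρ z hz, ?_⟩
        rw [hev' z (hZρ z hz), Multiset.prod_eq_zero (Multiset.mem_map.2 ⟨z, hz, sub_self z⟩),
          zero_mul]
    have hord : ∀ z ∈ Z.toFinset, analyticOrderNatAt (psEval F) z = Z.count z := by
      intro z hz
      have hzρ := hZρ z (Multiset.mem_toFinset.1 hz)
      have hev2 : psEval F =ᶠ[𝓝 z] (fun x => (Z.map fun w => x - w).prod) *
          fun x => ∑' i, u i * x ^ i := by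
        -- The open ball of radius ρ around z lies in the circle, so the factorization holds near z.
        -- Its second factor does not vanish there, and the order at z is the multiplicity in `Z`.
        filter_upwards [Metric.ball_mem_nhds z hρ] with x hx
        refine hev' x ?_
        rw [mem_ball_iff_norm, ← hzρ] at hx
        rw [← hzρ, ← norm_add_eq_left_of_lt hx, add_sub_cancel]
      have hua := analyticAt_tsum hρ hu0 hzρ
      obtain ⟨hP1, hP2⟩ := analyticOrderAt_prod_sub Z z
      rw [analyticOrderNatAt, analyticOrderAt_congr hev2, analyticOrderAt_mul hP1 hua, hP2,
        hua.analyticOrderAt_eq_zero.2 (hu_ne z hzρ), add_zero, ENat.toNat_natCast]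
    rw [_root_.circlePoly, hset, finprod_mem_coe_finset, Finset.prod_multiset_map_count]
    exact Finset.prod_congr rfl fun z hz => by rw [hord z hz]
  · rw [hev' x hx, norm_mul, hun x hx, mul_comm, norm_prod_map]

end CirclePolynomial

/-! ### Products of distances and resultants. -/

section DistanceProducts

variable {𝕜 : Type*} [NormedField 𝕜]

/-- The product of the distances from `x` to the points of `Z`, that is, the absolute value at `x`
of the monic polynomial with the roots `Z`. -/
def distProd (Z : Multiset 𝕜) (x : 𝕜) : ℝ := (Z.map fun z => ‖x - z‖).prod

theorem distProd_nonneg (Z : Multiset 𝕜) (x : 𝕜) : 0 ≤ distProd Z x :=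
  Multiset.prod_map_nonneg fun _ _ => norm_nonneg _

theorem distProd_eq_zero_iff {Z : Multiset 𝕜} {x : 𝕜} : distProd Z x = 0 ↔ x ∈ Z := by
  rw [distProd, Multiset.prod_eq_zero_iff, Multiset.mem_map]
  constructor
  · rintro ⟨z, hz, h⟩
    rwa [sub_eq_zero.1 (norm_eq_zero.1 h)]
  · exact fun h => ⟨x, h, by simp⟩

theorem prod_distProd_comm (Z W : Multiset 𝕜) :
    (Z.map (distProd W)).prod = (W.map (distProd Z)).prod := by
  unfold distProd
  rw [Multiset.prod_map_prod_map]
  simp only [norm_sub_rev]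

theorem Multiset.prod_map_le_one {ι : Type*} {m : Multiset ι} {g : ι → ℝ}
    (h0 : ∀ i ∈ m, 0 ≤ g i) (h1 : ∀ i ∈ m, g i ≤ 1) : (m.map g).prod ≤ 1 := by
  simpa using Multiset.prod_map_le_prod_map₀ g (fun _ => 1) h0 h1

theorem Multiset.prod_map_le_pow_card_of_le {ι : Type*} {m T : Multiset ι} (hT : T ≤ m) {g : ι → ℝ}
    (h0 : ∀ i ∈ m, 0 ≤ g i) (h1 : ∀ i ∈ m, g i ≤ 1) {c : ℝ} (hc : ∀ i ∈ T, g i = c) :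
    (m.map g).prod ≤ c ^ T.card := by
  obtain ⟨T', rfl⟩ := Multiset.le_iff_exists_add.1 hT
  have e : T.map g = T.map fun _ => c := Multiset.map_congr rfl hc
  have h2 : 0 ≤ (T.map g).prod :=
    Multiset.prod_map_nonneg fun i hi => h0 i (Multiset.mem_add.2 (Or.inl hi))
  rw [Multiset.map_add, Multiset.prod_add]
  calc _ ≤ (T.map g).prod * 1 := by
        refine mul_le_mul_of_nonneg_left (Multiset.prod_map_le_one ?_ ?_) h2
        · exact fun i hi => h0 i (Multiset.mem_add.2 (Or.inr hi))
        · exact fun i hi => h1 i (Multiset.mem_add.2 (Or.inr hi))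
    _ = _ := by rw [e, mul_one, Multiset.map_const', Multiset.prod_replicate]

theorem Multiset.abs_prod_map_sub_prod_map_le {ι : Type*} {m : Multiset ι} {g h : ι → ℝ} {δ : ℝ}
    (g0 : ∀ i ∈ m, 0 ≤ g i) (g1 : ∀ i ∈ m, g i ≤ 1) (h0 : ∀ i ∈ m, 0 ≤ h i)
    (h1 : ∀ i ∈ m, h i ≤ 1) (hδ : ∀ i ∈ m, |g i - h i| ≤ δ) :
    |(m.map g).prod - (m.map h).prod| ≤ m.card * δ := by
  induction m using Multiset.induction_on with
  | empty => simp
  | cons a m ih =>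
    simp only [Multiset.mem_cons, forall_eq_or_imp] at g0 g1 h0 h1 hδ
    have ih := ih g0.2 g1.2 h0.2 h1.2 hδ.2
    have p1 := Multiset.prod_map_le_one g0.2 g1.2
    have p0 := Multiset.prod_map_nonneg g0.2
    simp only [Multiset.map_cons, Multiset.prod_cons, Multiset.card_cons]
    calc |g a * (m.map g).prod - h a * (m.map h).prod|
        = |(g a - h a) * (m.map g).prod + h a * ((m.map g).prod - (m.map h).prod)| := by ring_nf
      _ ≤ |(g a - h a) * (m.map g).prod| + |h a * ((m.map g).prod - (m.map h).prod)| :=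
        abs_add_le _ _
      _ ≤ δ * 1 + 1 * (m.card * δ) := by
        rw [abs_mul, abs_mul, abs_of_nonneg p0, abs_of_nonneg h0.1]
        exact add_le_add (mul_le_mul hδ.1 p1 p0 ((abs_nonneg _).trans hδ.1))
          (mul_le_mul h1.1 ih (abs_nonneg _) zero_le_one)
      _ = _ := by push_cast; ring

/-- The smallest factor is at most the geometric mean; this gives the lower bound of the theorem. -/
theorem Multiset.exists_pow_card_le_prod_map {ι : Type*} {m : Multiset ι} (hm : m ≠ 0) {g : ι → ℝ}
    (h0 : ∀ i ∈ m, 0 ≤ g i) : ∃ i ∈ m, g i ^ m.card ≤ (m.map g).prod := by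
  classical
  obtain ⟨i, hi, hmin⟩ := m.toFinset.exists_min_image g (by simpa using hm)
  rw [Multiset.mem_toFinset] at hi
  exact ⟨i, hi, Multiset.pow_card_le_prod_map m (h0 i hi)
    fun j hj => hmin j (Multiset.mem_toFinset.2 hj)⟩

theorem exists_nearest {T : Multiset 𝕜} (hT : T ≠ 0) (x : 𝕜) :
    ∃ y ∈ T, ∀ w ∈ T, ‖x - y‖ ≤ ‖x - w‖ := by
  classical
  obtain ⟨y, hy, hmin⟩ := T.toFinset.exists_min_image (fun w => ‖x - w‖) (by simpa using hT)
  exact ⟨y, Multiset.mem_toFinset.1 hy, fun w hw => hmin w (Multiset.mem_toFinset.2 hw)⟩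

variable [IsUltrametricDist 𝕜]

theorem distProd_le_of_nearest {W : Multiset 𝕜} {x y : 𝕜} (h : ∀ w ∈ W, ‖x - y‖ ≤ ‖x - w‖) :
    distProd W y ≤ distProd W x := by
  refine Multiset.prod_map_le_prod_map₀ _ _ (fun _ _ => norm_nonneg _) fun w hw => ?_
  calc ‖y - w‖ = ‖(x - w) - (x - y)‖ := by congr 1; ring
    _ ≤ max ‖x - w‖ ‖x - y‖ := norm_sub_le_max_norm _ _
    _ = _ := max_eq_left (h w hw)

theorem exists_mem_distProd_le {Z W : Multiset 𝕜} (hZ : Z ≠ 0) (x : 𝕜) :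
    ∃ y ∈ Z + W, distProd Z y ≤ distProd Z x ∧ distProd W y ≤ distProd W x := by
  obtain ⟨y, hy, h⟩ := exists_nearest (T := Z + W) (by simp [hZ]) x
  exact ⟨y, hy, distProd_le_of_nearest fun w hw => h w (by simp [hw]),
    distProd_le_of_nearest fun w hw => h w (by simp [hw])⟩

theorem distProd_le_one {ρ : ℝ} (hρ1 : ρ ≤ 1) {W : Multiset 𝕜} (hW : ∀ w ∈ W, ‖w‖ = ρ) {x : 𝕜}
    (hx : ‖x‖ = ρ) : distProd W x ≤ 1 := by
  refine Multiset.prod_map_le_one (fun _ _ => norm_nonneg _) fun w hw => ?_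
  exact (norm_sub_le_max_norm _ _).trans (max_le (hx.le.trans hρ1) ((hW w hw).le.trans hρ1))

/-- If each point of `Z` and of `W` satisfies a lower bound for its share in the resultant, then
the resultant is bounded by the values of the two polynomials at any point. -/
theorem prod_distProd_rpow_le {Z W : Multiset 𝕜} (hZ : Z ≠ 0) {c : ℝ}
    (h1 : ∀ y ∈ Z, (Z.map (distProd W)).prod ^ c ≤ distProd W y)
    (h2 : ∀ y ∈ W, (W.map (distProd Z)).prod ^ c ≤ distProd Z y) (x : 𝕜) :
    (Z.map (distProd W)).prod ^ c ≤ max (distProd Z x) (distProd W x) := by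
  obtain ⟨y, hy, hyZ, hyW⟩ := exists_mem_distProd_le (W := W) hZ x
  rcases Multiset.mem_add.1 hy with hy | hy
  · exact (h1 y hy).trans (hyW.trans (le_max_right _ _))
  · rw [prod_distProd_comm]
    exact (h2 y hy).trans (hyZ.trans (le_max_left _ _))

end DistanceProducts

/-! ### Conjugates over K. -/

section RationalCoefficients

open Polynomial

variable {p : ℕ} [hp : Fact p.Prime]

/-- On algebraic elements the norm is the spectral norm, which depends only on the minimal
polynomial over ℚ_p. -/
theorem norm_eq_of_minpoly_eq {y y' : ℂ_[p]} (hy : IsIntegral ℚ_[p] y)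
    (h : minpoly ℚ_[p] y = minpoly ℚ_[p] y') : ‖y‖ = ‖y'‖ := by
  have key : ∀ y : ℂ_[p], IsIntegral ℚ_[p] y → ‖y‖ = spectralValue (minpoly ℚ_[p] y) := by
    intro y hy
    have := IntermediateField.isAlgebraic_adjoin_simple hy
    have h1 := NormedAlgebra.norm_eq_spectralNorm ℚ_[p]
      (IntermediateField.AdjoinSimple.gen ℚ_[p] y)
    rw [spectralNorm, IntermediateField.minpoly_gen] at h1
    rw [← h1]
    rfl
  have hy' : IsIntegral ℚ_[p] y' := by
    by_contra hn
    rw [minpoly.eq_zero hn] at h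
    exact minpoly.ne_zero hy h
  rw [key y hy, key y' hy', h]

variable (K : IntermediateField ℚ_[p] ℂ_[p]) [FiniteDimensional ℚ_[p] K]

/-- If m is the minimal polynomial of Q(z) over ℚ_p, then m ∘ Q vanishes at z, hence at its
K-conjugate z'. So Q(z) and Q(z') have the same minimal polynomial. -/
theorem norm_aeval_eq_of_conj {z z' : ℂ_[p]} (hz : IsIntegral K z)
    (h : aeval z' (minpoly K z) = 0) (Q : K[X]) : ‖aeval z Q‖ = ‖aeval z' Q‖ := by
  have hK : ∀ y : ℂ_[p], IsIntegral K y → IsIntegral ℚ_[p] y := fun y hy => isIntegral_trans y hy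
  have hQ : IsIntegral K (aeval z Q) := by
    exact Algebra.adjoin_le (S := integralClosure K ℂ_[p]) (Set.singleton_subset_iff.2 hz)
      (aeval_mem_adjoin_singleton K z)
  have hQ' := hK _ hQ
  refine norm_eq_of_minpoly_eq hQ' ?_
  refine minpoly.eq_of_irreducible_of_monic (minpoly.irreducible hQ') ?_ (minpoly.monic hQ')
  have h1 : aeval z (((minpoly ℚ_[p] (aeval z Q)).map (algebraMap ℚ_[p] K)).comp Q) = 0 := by
    rw [aeval_comp, aeval_map_algebraMap, minpoly.aeval]
  obtain ⟨q, hq⟩ := minpoly.dvd K z h1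
  have h2 : aeval z' (((minpoly ℚ_[p] (aeval z Q)).map (algebraMap ℚ_[p] K)).comp Q) = 0 := by
    rw [hq, map_mul, h, zero_mul]
  rwa [aeval_comp, aeval_map_algebraMap] at h2

variable {K} {ϖ : ℂ_[p]}

omit [FiniteDimensional ℚ_[p] K] in
theorem IsUnif.norm_eq_zpow (hϖ : IsUnif K ϖ) {x : ℂ_[p]} (hx : x ∈ K) (hx0 : x ≠ 0) :
    ‖x‖ = ‖ϖ‖ ^ vPi ϖ x := by
  obtain ⟨hϖK, hϖ0, hϖ1, hmax⟩ := hϖ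
  have hpos := norm_pos_iff.2 hϖ0
  have hex : ∃ d : ℤ, ‖x‖ = ‖ϖ‖ ^ d := by
    obtain ⟨n, hn1, hn2⟩ := exists_mem_Ioc_zpow (norm_pos_iff.2 hx0) ((one_lt_inv₀ hpos).2 hϖ1)
    simp only [inv_zpow'] at hn1 hn2
    refine ⟨-(n + 1), le_antisymm hn2 ?_⟩
    by_contra! hlt
    -- Otherwise this element of K has norm strictly between ‖ϖ‖ and 1.
    have h1 := hmax (x * ϖ ^ (n + 1)) (K.mul_mem hx (zpow_mem hϖK _)) (by
      rw [norm_mul, norm_zpow]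
      calc _ < ‖ϖ‖ ^ (-(n + 1)) * ‖ϖ‖ ^ (n + 1) := by gcongr
        _ = 1 := by rw [← zpow_add₀ hpos.ne']; simp)
    rw [norm_mul, norm_zpow] at h1
    have h2 : ‖ϖ‖ < ‖x‖ * ‖ϖ‖ ^ (n + 1) := by
      calc ‖ϖ‖ = ‖ϖ‖ ^ (-n) * ‖ϖ‖ ^ (n + 1) := by rw [← zpow_add₀ hpos.ne']; simp
        _ < _ := by gcongr
    linarith
  rw [vPi, dif_pos hex]
  exact hex.choose_spec

/-- The degree over `K` of an element of valuation `(v(b) - v(a)) / d`. -/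
theorem IsUnif.dvd_natDegree_mul_gcd (hϖ : IsUnif K ϖ) {z a b : ℂ_[p]} (hz : IsIntegral K z)
    (ha : a ∈ K) (hb : b ∈ K) (ha0 : a ≠ 0) (hb0 : b ≠ 0) {d : ℕ}
    (hd : ‖a‖ * ‖z‖ ^ d = ‖b‖) :
    (d : ℤ) ∣ (minpoly K z).natDegree * Int.gcd (vPi ϖ a - vPi ϖ b) d := by
  set g := minpoly K z with hg
  have hmon : g.Monic := minpoly.monic hz
  have hpos := norm_pos_iff.2 hϖ.2.1
  rcases Nat.eq_zero_or_pos d with rfl | hdpos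
  · have : vPi ϖ a = vPi ϖ b := by
      rw [pow_zero, mul_one, hϖ.norm_eq_zpow ha ha0, hϖ.norm_eq_zpow hb hb0] at hd
      exact zpow_right_injective₀ hpos hϖ.2.2.1.ne hd
    simp [this]
  have hz0 : z ≠ 0 := by
    rintro rfl
    rw [norm_zero, zero_pow hdpos.ne', mul_zero] at hd
    exact hb0 (norm_eq_zero.1 hd.symm)
  have hspl : (g.map (algebraMap K ℂ_[p])).Splits := IsAlgClosed.splits _
  have hroot : ∀ w ∈ (g.map (algebraMap K ℂ_[p])).roots, ‖w‖ = ‖z‖ := by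
    intro w hw
    have h1 : aeval w g = 0 := by
      rw [aeval_def, ← eval_map]; exact (mem_roots'.1 hw).2
    simpa using (norm_aeval_eq_of_conj K hz h1 X).symm
  have hcoeff : ‖((g.coeff 0 : K) : ℂ_[p])‖ = ‖z‖ ^ g.natDegree := by
    have h1 := hspl.coeff_zero_eq_prod_roots_of_monic (hmon.map _)
    rw [coeff_map] at h1
    have h2 : ((g.coeff 0 : K) : ℂ_[p]) = algebraMap K ℂ_[p] (g.coeff 0) := rfl
    rw [h2, h1, norm_mul, norm_pow, norm_neg, norm_one, one_pow, one_mul,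
      ← Multiset.map_id (g.map (algebraMap K ℂ_[p])).roots, norm_prod_map,
      Multiset.map_congr (f := fun i => ‖id i‖) rfl (g := fun _ => ‖z‖) hroot, Multiset.map_const', Multiset.prod_replicate,
      ← hspl.natDegree_eq_card_roots, hmon.natDegree_map]
  have hc0 : ((g.coeff 0 : K) : ℂ_[p]) ≠ 0 := by
    rw [← norm_ne_zero_iff, hcoeff]
    exact pow_ne_zero _ (norm_ne_zero_iff.2 hz0)
  rw [hϖ.norm_eq_zpow (g.coeff 0).2 hc0] at hcoeff
  rw [hϖ.norm_eq_zpow ha ha0, hϖ.norm_eq_zpow hb hb0] at hd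
  set j := vPi ϖ ((g.coeff 0 : K) : ℂ_[p])
  set va := vPi ϖ a
  set vb := vPi ϖ b
  -- The constant coefficient of `g` has norm ‖z‖ ^ deg g and integral valuation j; eliminating ‖z‖
  -- gives d ∣ deg g · (va - vb), and Bézout replaces va - vb by its gcd with d.
  have h3 : ‖ϖ‖ ^ (va * g.natDegree + j * d) = ‖ϖ‖ ^ (vb * g.natDegree) := by
    rw [zpow_add₀ hpos.ne', zpow_mul, zpow_mul, zpow_mul, hcoeff, ← hd]
    simp only [zpow_natCast]
    rw [mul_pow, ← pow_mul, ← pow_mul, mul_comm d]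
  have h4 : va * g.natDegree + j * d = vb * g.natDegree :=
    zpow_right_injective₀ hpos hϖ.2.2.1.ne h3
  have h5 : (d : ℤ) ∣ g.natDegree * (va - vb) := ⟨-j, by linear_combination h4⟩
  rw [Int.gcd_eq_gcd_ab, mul_add]
  refine dvd_add ?_ ?_
  · rw [← mul_assoc]; exact h5.mul_right _
  · exact ⟨_, mul_left_comm _ _ _⟩

/-- A root `z` over `K` of `P` shares its distance product to the roots of `Q` with its
conjugates. -/
theorem prod_distProd_rpow_le_of_conj {ρ : ℝ} (hρ1 : ρ ≤ 1) {P Q : K[X]} (hP0 : P ≠ 0)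
    {Z W : Multiset ℂ_[p]} (hZ : ∀ z ∈ Z, ‖z‖ = ρ) (hW : ∀ w ∈ W, ‖w‖ = ρ) {C D : ℝ}
    (hD : 0 < D)
    (hP : ∀ x : ℂ_[p], ‖x‖ = ρ → ‖aeval x P‖ = C * distProd Z x)
    (hC : 0 < C)
    (hQ : ∀ x : ℂ_[p], ‖x‖ = ρ → ‖aeval x Q‖ = D * distProd W x) {z : ℂ_[p]} (hz : z ∈ Z)
    {c : ℝ} (hc : 0 ≤ c) (hdeg : IsIntegral K z → 1 ≤ (minpoly K z).natDegree * c) :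
    (Z.map (distProd W)).prod ^ c ≤ distProd W z := by
  have hzP : aeval z P = 0 := by
    rw [← norm_eq_zero, hP z (hZ z hz), distProd_eq_zero_iff.2 hz, mul_zero]
  have hint : IsIntegral K z := (IsAlgebraic.isIntegral ⟨P, hP0, hzP⟩)
  set T := (minpoly K z).aroots ℂ_[p] with hT
  have hTmem : ∀ w ∈ T, aeval w (minpoly K z) = 0 := fun w hw => (mem_aroots'.1 hw).2
  have hTnorm : ∀ w ∈ T, ‖w‖ = ρ := fun w hw => by
    rw [← hZ z hz]; simpa using (norm_aeval_eq_of_conj K hint (hTmem w hw) X).symm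
  have hnodup : T.Nodup := by
    have hsep : (minpoly K z).Separable := (minpoly.irreducible hint).separable
    exact nodup_roots hsep.map
  have hTcard : T.card = (minpoly K z).natDegree := by
    rw [hT, aroots, ← (IsAlgClosed.splits _).natDegree_eq_card_roots, natDegree_map]
  -- Separability makes the conjugates distinct, so they form a submultiset of `Z` as soon as they
  -- all belong to it.
  have hTZ : T ≤ Z := (Multiset.le_iff_subset hnodup).2 fun w hw => by
    obtain ⟨q, hq⟩ := minpoly.dvd K z hzP
    have h1 : aeval w P = 0 := by rw [hq, map_mul, hTmem w hw, zero_mul]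
    rw [← norm_eq_zero, hP w (hTnorm w hw)] at h1
    exact distProd_eq_zero_iff.1 ((mul_eq_zero.1 h1).resolve_left hC.ne')
  have hval : ∀ w ∈ T, distProd W w = distProd W z := fun w hw => by
    have h1 := norm_aeval_eq_of_conj K hint (hTmem w hw) Q
    rw [hQ z (hZ z hz), hQ w (hTnorm w hw)] at h1
    exact (mul_left_cancel₀ hD.ne' h1).symm
  have hle := Multiset.prod_map_le_pow_card_of_le hTZ (fun w _ => distProd_nonneg W w)
    (fun w hw => distProd_le_one hρ1 hW (hZ w hw)) hval
  have h0 : 0 ≤ (Z.map (distProd W)).prod :=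
    Multiset.prod_map_nonneg fun w _ => distProd_nonneg W w
  have h0' := distProd_nonneg W z
  calc _ ≤ (distProd W z ^ T.card) ^ c := Real.rpow_le_rpow h0 hle hc
    _ = distProd W z ^ (T.card * c) := by
      rw [← Real.rpow_natCast, ← Real.rpow_mul h0']
    _ ≤ distProd W z ^ (1 : ℝ) := by
      rcases h0'.eq_or_lt with h | h
      · have h2 := hdeg hint
        rw [← h, Real.zero_rpow one_ne_zero, Real.zero_rpow]
        rw [hTcard]; linarith
      · exact Real.rpow_le_rpow_of_exponent_ge h (distProd_le_one hρ1 hW (hZ z hz))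
          (by rw [hTcard]; exact hdeg hint)
    _ = _ := Real.rpow_one _

end RationalCoefficients

/-! ### Approximation by polynomials over K. -/

section RationalApproximation

open Filter Topology Polynomial

variable {p : ℕ} [hp : Fact p.Prime] {ρ : ℝ} {f g : ℕ → ℂ_[p]} {s t s' t' : ℕ}

theorem exists_map_eq_truncPoly (K : IntermediateField ℚ_[p] ℂ_[p]) (hK : ∀ i, f i ∈ K) (N : ℕ) :
    ∃ P : K[X], P.map (algebraMap K ℂ_[p]) = truncPoly f N := by
  refine ⟨∑ i ∈ Finset.range N, monomial i ⟨f i, hK i⟩, ?_⟩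
  rw [truncPoly, Polynomial.map_sum]
  exact Finset.sum_congr rfl fun i _ => by rw [map_monomial]; rfl

theorem GaussInterval.scale_pos (h : GaussInterval ρ f s t) (hρ : 0 < ρ) : 0 < ‖f t‖ * ρ ^ s := by
  have h1 : 0 < ‖f t‖ * ρ ^ t := h.eq ▸ h.pos hρ
  exact mul_pos (pos_of_mul_pos_left h1 (by positivity)) (pow_pos hρ s)

/-- A power series over `K` is approximated on a circle by polynomials over `K` with the same
number of roots on it. -/
theorem GaussInterval.exists_rational_approx (h : GaussInterval ρ f s t) (hρ : 0 < ρ)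
    (hf : Tendsto (fun i => ‖f i‖ * ρ ^ i) atTop (𝓝 0)) {K : IntermediateField ℚ_[p] ℂ_[p]}
    (hK : ∀ i, f i ∈ K) {Z : Multiset ℂ_[p]}
    (hZ : ∀ x : ℂ_[p], ‖x‖ = ρ → ‖∑' i, f i * x ^ i‖ = ‖f t‖ * ρ ^ s * distProd Z x)
    {δ : ℝ} (hδ : 0 < δ) :
    ∃ (P : K[X]) (Z' : Multiset ℂ_[p]), P ≠ 0 ∧ Z'.card = t - s ∧ (∀ z ∈ Z', ‖z‖ = ρ) ∧
      (∀ x : ℂ_[p], ‖x‖ = ρ → ‖aeval x P‖ = ‖f t‖ * ρ ^ s * distProd Z' x) ∧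
      ∀ x : ℂ_[p], ‖x‖ = ρ → |distProd Z' x - distProd Z x| ≤ δ := by
  classical
  set C := ‖f t‖ * ρ ^ s with hCdef
  have hC : 0 < C := h.scale_pos hρ
  obtain ⟨M, hM⟩ :=
    ((hf.eventually_lt_const (mul_pos hC hδ)).mono fun _ h => h.le).exists_forall_of_atTop
  set N := max M (t + 1)
  have htN : t < N := le_max_right M (t + 1)
  obtain ⟨P, hP⟩ := exists_map_eq_truncPoly K hK N
  have hGI := h.truncPoly hρ htN
  obtain ⟨h1, h2⟩ := hGI.polynomial_roots hρ
  have hPe : ∀ x : ℂ_[p], ‖x‖ = ρ → ‖aeval x P‖ = C *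
      distProd ((_root_.truncPoly f N).roots.filter fun z => ‖z‖ = ρ) x := fun x hx => by
    rw [aeval_def, ← eval_map, hP, h2 x hx, coeff_truncPoly, if_pos htN]; rfl
  refine ⟨P, (_root_.truncPoly f N).roots.filter fun z => ‖z‖ = ρ, ?_, h1,
    fun z hz => (Multiset.mem_filter.1 hz).2, hPe, fun x hx => ?_⟩
  · rintro rfl
    rw [Polynomial.map_zero] at hP
    exact hGI.ne_zero (by rw [← hP]; simp)
  · refine le_of_mul_le_mul_left ?_ hC
    rw [← abs_of_pos hC, ← abs_mul, abs_of_pos hC, mul_sub, ← hPe x hx, ← hZ x hx]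
    refine (abs_norm_sub_norm_le _ _).trans ?_
    rw [aeval_def, ← eval_map, hP, norm_sub_rev]
    exact norm_tsum_sub_eval_truncPoly_le hf (by positivity) hM (le_max_left _ _) hx

/-- Replace `W'` by `W` first, then `Z'` by `Z` after exchanging the roles of the two multisets. The
approximants have a fixed number of roots, so this shows that their resultants converge in absolute
value. -/
theorem abs_prod_distProd_sub_le {𝕜 : Type*} [NormedField 𝕜] [IsUltrametricDist 𝕜] {ρ : ℝ}
    (hρ1 : ρ ≤ 1) {Z W Z' W' : Multiset 𝕜} (hZ : ∀ z ∈ Z, ‖z‖ = ρ) (hW : ∀ w ∈ W, ‖w‖ = ρ)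
    (hZ' : ∀ z ∈ Z', ‖z‖ = ρ) (hW' : ∀ w ∈ W', ‖w‖ = ρ) {δ : ℝ}
    (h1 : ∀ x : 𝕜, ‖x‖ = ρ → |distProd Z' x - distProd Z x| ≤ δ)
    (h2 : ∀ x : 𝕜, ‖x‖ = ρ → |distProd W' x - distProd W x| ≤ δ) :
    |(Z'.map (distProd W')).prod - (Z.map (distProd W)).prod| ≤ (Z'.card + W.card) * δ := by
  have e1 := Multiset.abs_prod_map_sub_prod_map_le (m := Z') (fun z _ => distProd_nonneg W' z)
    (fun z hz => distProd_le_one hρ1 hW' (hZ' z hz)) (fun z _ => distProd_nonneg W z)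
    (fun z hz => distProd_le_one hρ1 hW (hZ' z hz)) fun z hz => h2 z (hZ' z hz)
  have e2 := Multiset.abs_prod_map_sub_prod_map_le (m := W) (fun z _ => distProd_nonneg Z' z)
    (fun z hz => distProd_le_one hρ1 hZ' (hW z hz)) (fun z _ => distProd_nonneg Z z)
    (fun z hz => distProd_le_one hρ1 hZ (hW z hz)) fun z hz => h1 z (hW z hz)
  rw [← prod_distProd_comm Z', ← prod_distProd_comm Z] at e2
  calc _ ≤ _ := abs_sub_le _ (Z'.map (distProd W)).prod _
    _ ≤ _ := add_le_add e1 e2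
    _ = _ := by ring

/-- The resultant bound for power series over `K`, where every point of the circle that is
algebraic over `K` has degree at least `1 / c`. -/
theorem prod_distProd_rpow_le_of_rational (hρ : 0 < ρ) (hρ1 : ρ ≤ 1)
    (hf : GaussInterval ρ f s t) (hg : GaussInterval ρ g s' t') (hst : s < t)
    (hf0 : Tendsto (fun i => ‖f i‖ * ρ ^ i) atTop (𝓝 0))
    (hg0 : Tendsto (fun i => ‖g i‖ * ρ ^ i) atTop (𝓝 0))
    {K : IntermediateField ℚ_[p] ℂ_[p]} [FiniteDimensional ℚ_[p] K]
    (hfK : ∀ i, f i ∈ K) (hgK : ∀ i, g i ∈ K) {Z W : Multiset ℂ_[p]}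
    (hZ : ∀ z ∈ Z, ‖z‖ = ρ) (hW : ∀ w ∈ W, ‖w‖ = ρ)
    (hfZ : ∀ x : ℂ_[p], ‖x‖ = ρ → ‖∑' i, f i * x ^ i‖ = ‖f t‖ * ρ ^ s * distProd Z x)
    (hgW : ∀ x : ℂ_[p], ‖x‖ = ρ → ‖∑' i, g i * x ^ i‖ = ‖g t'‖ * ρ ^ s' * distProd W x)
    {c : ℝ} (hc : 0 ≤ c)
    (hdeg : ∀ z : ℂ_[p], ‖z‖ = ρ → IsIntegral K z → 1 ≤ (minpoly K z).natDegree * c)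
    {x : ℂ_[p]} (hx : ‖x‖ = ρ) :
    (Z.map (distProd W)).prod ^ c ≤ max (distProd Z x) (distProd W x) := by
  have hδ : ∀ n : ℕ, (0 : ℝ) < 1 / ((n : ℝ) + 1) := fun n => by positivity
  choose P Z' hP0 hZcard hZ' hPZ hZclose using fun n => hf.exists_rational_approx hρ hf0 hfK hfZ (hδ n)
  choose Q W' hQ0 hWcard hW' hQW hWclose using fun n => hg.exists_rational_approx hρ hg0 hgK hgW (hδ n)
  have hC := hf.scale_pos hρ
  have hD := hg.scale_pos hρ
  have hlim : ∀ {u : ℕ → ℝ} {a B : ℝ}, (∀ n, |u n - a| ≤ B * (1 / ((n : ℝ) + 1))) →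
      Tendsto u atTop (𝓝 a) := fun {u a B} hu => by
    rw [tendsto_iff_norm_sub_tendsto_zero]
    refine squeeze_zero (fun _ => norm_nonneg _) hu ?_
    simpa using tendsto_one_div_add_atTop_nhds_zero_nat.const_mul B
  have hR : Tendsto (fun n => ((Z' n).map (distProd (W' n))).prod) atTop
      (𝓝 (Z.map (distProd W)).prod) :=
    hlim (B := ((t - s : ℕ) : ℝ) + W.card) fun n => by
      have := abs_prod_distProd_sub_le hρ1 hZ hW (hZ' n) (hW' n) (hZclose n) (hWclose n)
      rwa [hZcard n] at this
  have hZx : Tendsto (fun n => distProd (Z' n) x) atTop (𝓝 (distProd Z x)) :=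
    hlim (B := 1) fun n => by rw [one_mul]; exact hZclose n x hx
  have hWx : Tendsto (fun n => distProd (W' n) x) atTop (𝓝 (distProd W x)) :=
    hlim (B := 1) fun n => by rw [one_mul]; exact hWclose n x hx
  refine le_of_tendsto_of_tendsto' ((Real.continuous_rpow_const hc).tendsto _ |>.comp hR)
    (hZx.max hWx) fun n => ?_
  refine prod_distProd_rpow_le ?_ (fun y hy => ?_) (fun y hy => ?_) x
  · rw [← Multiset.card_pos, hZcard]; omega
  · exact prod_distProd_rpow_le_of_conj hρ1 (hP0 n) (hZ' n) (hW' n) hD (hPZ n) hC (hQW n) hy hc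
      (hdeg y (hZ' n y hy))
  · exact prod_distProd_rpow_le_of_conj hρ1 (hQ0 n) (hW' n) (hZ' n) hC (hQW n) hD (hPZ n) hy hc
      (hdeg y (hW' n y hy))

end RationalApproximation

/-! ### Valuations of nonnegative reals, with 0 sent to ∞. -/

section ExtendedValuation

/-- The valuation `-log_p d` of an element of norm `d`. -/
noncomputable def normVal (p : ℕ) (d : ℝ) : EReal :=
  if d = 0 then ⊤ else ((-Real.logb (p : ℝ) d : ℝ) : EReal)

variable {p : ℕ} [hp : Fact p.Prime]

theorem vp_eq_normVal (x : ℂ_[p]) : vp x = normVal p ‖x‖ := by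
  by_cases hx : x = 0 <;> simp [vp, normVal, hx]

omit hp in
theorem normVal_of_pos {d : ℝ} (hd : 0 < d) :
    normVal p d = ((-Real.logb (p : ℝ) d : ℝ) : EReal) := by rw [normVal, if_neg hd.ne']

omit hp in
@[simp] theorem normVal_zero : normVal p 0 = ⊤ := by rw [normVal, if_pos rfl]

theorem normVal_anti {d e : ℝ} (hd : 0 ≤ d) (hde : d ≤ e) : normVal p e ≤ normVal p d := by
  rcases hd.eq_or_lt with rfl | hd
  · simp
  · rw [normVal_of_pos hd, normVal_of_pos (hd.trans_le hde), EReal.coe_le_coe_iff, neg_le_neg_iff,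
      Real.logb_le_logb one_lt_cast_prime hd (hd.trans_le hde)]
    exact hde

omit hp in
theorem normVal_mul {c d : ℝ} (hc : 0 < c) (hd : 0 ≤ d) :
    normVal p (c * d) = normVal p c + normVal p d := by
  rcases hd.eq_or_lt with rfl | hd
  · rw [mul_zero, normVal_zero, normVal_of_pos hc, EReal.coe_add_top]
  · rw [normVal_of_pos hc, normVal_of_pos hd, normVal_of_pos (mul_pos hc hd), ← EReal.coe_add,
      Real.logb_mul hc.ne' hd.ne']
    congr 1; ring

omit hp in
theorem normVal_rpow {c d : ℝ} (hc : 0 < c) (hd : 0 ≤ d) :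
    normVal p (d ^ c) = (c : EReal) * normVal p d := by
  rcases hd.eq_or_lt with rfl | hd
  · rw [Real.zero_rpow hc.ne', normVal_zero, EReal.coe_mul_top_of_pos hc]
  · rw [normVal_of_pos hd, normVal_of_pos (Real.rpow_pos_of_pos hd c), ← EReal.coe_mul,
      Real.logb_rpow_eq_mul_logb_of_pos hd]
    congr 1; ring

omit hp in
theorem normVal_div {c d : ℝ} (hc : 0 < c) (hd : 0 ≤ d) :
    normVal p d / (c : EReal) = normVal p (d ^ c⁻¹) := by
  rw [normVal_rpow (inv_pos.2 hc) hd, EReal.div_eq_inv_mul, EReal.coe_inv]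

end ExtendedValuation

/-! ### Translating the data of the theorem. -/

section CircleData

open Filter Topology

variable {p : ℕ} [hp : Fact p.Prime] {F G : PowerSeries ℂ_[p]} {k : ℕ → ℕ} {n : ℕ}

theorem IsCharSeq.rootVal_gaussInterval (h : IsCharSeq F k n) (hn : 1 ≤ n) :
    ∃ α : ℝ, rootVal F k n = α ∧ k (n - 1) < k n ∧
      GaussInterval ((p : ℝ) ^ (-α)) (fun i => PowerSeries.coeff i F) (k (n - 1)) (k n) := by
  obtain ⟨n, rfl⟩ := Nat.exists_eq_add_of_le' hn
  obtain ⟨α, hα, hGI⟩ := h.gaussInterval n (by omega)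
  exact ⟨α, hα, (h.2 n (by omega)).1.1, hGI⟩

/-- Convergence is assumed only at points of the circle, so one such point is needed; a root of a
truncation provides it. -/
theorem GaussInterval.exists_norm_eq {𝕜 : Type*} [NontriviallyNormedField 𝕜] [IsUltrametricDist 𝕜]
    [IsAlgClosed 𝕜] {ρ : ℝ} {f : ℕ → 𝕜} {s t : ℕ} (h : GaussInterval ρ f s t) (hst : s < t)
    (hρ : 0 < ρ) : ∃ x : 𝕜, ‖x‖ = ρ := by
  classical
  obtain ⟨h1, -⟩ := (h.truncPoly hρ (Nat.lt_succ_self t)).polynomial_roots hρ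
  obtain ⟨x, hx⟩ := Multiset.card_pos_iff_exists_mem.1 ((Nat.sub_pos_of_lt hst).trans_eq h1.symm)
  exact ⟨x, (Multiset.mem_filter.1 hx).2⟩

theorem shiftedVal_eq {α : ℝ} (hα : rootVal F k n = α) (hne : PowerSeries.coeff (k n) F ≠ 0) :
    shiftedVal F k n =
      normVal p (‖PowerSeries.coeff (k n) F‖ * ((p : ℝ) ^ (-α)) ^ k (n - 1)) := by
  have h0 : (0 : ℝ) < p := by linarith [one_lt_cast_prime (p := p)]
  have h1 := norm_pos_iff.2 hne
  have h2 := Real.rpow_pos_of_pos h0 (-α)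
  rw [shiftedVal, hα, vp_of_ne_zero hne, ← EReal.coe_mul, ← EReal.coe_add,
    normVal_of_pos (by positivity), logb_weight hne]
  congr 1; ring

theorem gcdRatio_pos {ϖ : ℂ_[p]} (hlt : k (n - 1) < k n) : 0 < gcdRatio ϖ F k n := by
  have h1 : (0 : ℝ) < (k n : ℝ) - k (n - 1) := sub_pos.2 (mod_cast hlt)
  have h2 : 0 < Int.gcd (vPi ϖ (PowerSeries.coeff (k n) F) -
      vPi ϖ (PowerSeries.coeff (k (n - 1)) F)) ((k n : ℤ) - (k (n - 1) : ℤ)) :=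
    Int.gcd_pos_of_ne_zero_right _ (by omega)
  exact div_pos (mod_cast h2) h1

/-- Equality of the two extreme weights says |F_{k_n}| |z|^d = |F_{k_{n-1}}| with d = k_n - k_{n-1}.
Thus the bound holds for every algebraic point of the circle, not only for zeros of `F`. -/
theorem one_le_natDegree_mul_gcdRatio {α : ℝ} {K : IntermediateField ℚ_[p] ℂ_[p]}
    [FiniteDimensional ℚ_[p] K] {ϖ : ℂ_[p]} (hϖ : IsUnif K ϖ)
    (hK : ∀ i : ℕ, PowerSeries.coeff i F ∈ K) (hlt : k (n - 1) < k n)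
    (h : GaussInterval ((p : ℝ) ^ (-α)) (fun i => PowerSeries.coeff i F) (k (n - 1)) (k n))
    {z : ℂ_[p]} (hz : ‖z‖ = (p : ℝ) ^ (-α)) (hint : IsIntegral K z) :
    1 ≤ ((minpoly K z).natDegree : ℝ) * gcdRatio ϖ F k n := by
  have h0 : (0 : ℝ) < p := by linarith [one_lt_cast_prime (p := p)]
  have hρ := Real.rpow_pos_of_pos h0 (-α)
  have hC := h.scale_pos hρ
  obtain ⟨d, hd⟩ := Nat.exists_eq_add_of_lt hlt
  have hkn : PowerSeries.coeff (k n) F ≠ 0 := fun h0 => by simp [h0] at hC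
  have hdvd := hϖ.dvd_natDegree_mul_gcd hint (hK (k n)) (hK (k (n - 1))) hkn h.ne_zero
    (d := d + 1) (by
      refine mul_right_cancel₀ (pow_pos hρ (k (n - 1))).ne' (Eq.trans ?_ h.eq)
      rw [hz, mul_assoc, ← pow_add, hd]
      congr 2; ring)
  have e1 : ((k n : ℤ) - (k (n - 1) : ℤ)) = ((d + 1 : ℕ) : ℤ) := by rw [hd]; push_cast; ring
  have e2 : ((k n : ℝ) - (k (n - 1) : ℝ)) = ((d + 1 : ℕ) : ℝ) := by rw [hd]; push_cast; ring
  rw [gcdRatio, e1, e2, ← mul_div_assoc, one_le_div (by positivity)]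
  have hpos : 0 < (minpoly K z).natDegree * Int.gcd (vPi ϖ (PowerSeries.coeff (k n) F) -
      vPi ϖ (PowerSeries.coeff (k (n - 1)) F)) ((d + 1 : ℕ) : ℤ) := by
    refine Nat.mul_pos (minpoly.natDegree_pos hint) (Int.gcd_pos_of_ne_zero_right _ ?_)
    exact_mod_cast Nat.succ_ne_zero d
  exact_mod_cast Nat.le_of_dvd hpos (by exact_mod_cast hdvd)

open Polynomial in
theorem norm_resultant_prod_linear {𝕜 : Type*} [NormedField 𝕜] (Z W : Multiset 𝕜) :
    ‖Polynomial.resultant (Z.map fun z => X - C z).prod (W.map fun w => X - C w).prod‖ =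
      (Z.map (distProd W)).prod := by
  have hs : (Z.map fun z => X - C z).prod.Splits :=
    Splits.multisetProd fun q hq => by
      obtain ⟨z, -, rfl⟩ := Multiset.mem_map.1 hq
      exact Splits.X_sub_C z
  have hm : (Z.map fun z => X - C z).prod.Monic := monic_multisetProd_X_sub_C Z
  rw [resultant_eq_prod_eval _ _ _ le_rfl hs, hm.leadingCoeff, one_pow, one_mul,
    roots_multiset_prod_X_sub_C, norm_prod_map]
  congr 1
  refine Multiset.map_congr rfl fun z _ => ?_
  rw [eval_multiset_prod, Multiset.map_map, norm_prod_map]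
  simp [distProd]

theorem prod_distProd_le_of_mem {Z W : Multiset ℂ_[p]} {ρ : ℝ} (hρ1 : ρ ≤ 1)
    (hZ : ∀ z ∈ Z, ‖z‖ = ρ) (hW : ∀ w ∈ W, ‖w‖ = ρ) {y : ℂ_[p]} (hy : y ∈ Z) :
    (Z.map (distProd W)).prod ^ (1 : ℝ) ≤ distProd W y := by
  have h := Multiset.prod_map_le_pow_card_of_le (Multiset.singleton_le.2 hy)
    (g := distProd W) (c := distProd W y) (fun z _ => distProd_nonneg W z)
    (fun z hz => distProd_le_one hρ1 hW (hZ z hz)) (by simp)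
  simpa using h

end CircleData

/-! ### The main theorem. -/

theorem theorem5p1 (p : ℕ) [Fact p.Prime] (F G : PowerSeries ℂ_[p]) (k l : ℕ → ℕ) (n m : ℕ)
    (hn : 1 ≤ n) (hm : 1 ≤ m) (hk : IsCharSeq F k n) (hl : IsCharSeq G l m)
    (hαβ : rootVal F k n = rootVal G l m)
    (hF : ∀ x ∈ circleC p (rootVal F k n), ConvergesAt F x)
    (hG : ∀ x ∈ circleC p (rootVal F k n), ConvergesAt G x)
    (a b : EReal) (ha : a = min (shiftedVal F k n) (shiftedVal G l m))
    (hb : b = max (shiftedVal F k n) (shiftedVal G l m))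
    (r : ℂ_[p])
    (hr : r = Polynomial.resultant (circlePoly F (rootVal F k n))
      (circlePoly G (rootVal G l m))) :
    ∃ S : EReal, IsGreatest (phi F G '' circleC p (rootVal F k n)) S ∧
      a + vp r / ((min ((l m : ℝ) - (l (m - 1) : ℝ)) ((k n : ℝ) - (k (n - 1) : ℝ)) : ℝ) : EReal)
        ≤ S ∧
      (0 ≤ rootVal F k n →
        S ≤ b + vp r ∧
        ∀ (K : IntermediateField ℚ_[p] ℂ_[p]) [FiniteDimensional ℚ_[p] K] (ϖ : ℂ_[p]),
          IsUnif K ϖ →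
          (∀ i : ℕ, PowerSeries.coeff i F ∈ K) → (∀ i : ℕ, PowerSeries.coeff i G ∈ K) →
          S ≤ b + ((max (gcdRatio ϖ F k n) (gcdRatio ϖ G l m) : ℝ) : EReal) * vp r) := by
  classical
  obtain ⟨α, hα, hkn, hFI⟩ := hk.rootVal_gaussInterval hn
  obtain ⟨β, hβ, hlm, hGI⟩ := hl.rootVal_gaussInterval hm
  obtain rfl : α = β := by rw [hα, hβ] at hαβ; exact_mod_cast hαβ
  have h1p := one_lt_cast_prime (p := p)
  have h0p : (0 : ℝ) < p := by linarith
  have hρ := Real.rpow_pos_of_pos h0p (-α)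
  have hC := hFI.scale_pos hρ
  have hD := hGI.scale_pos hρ
  have hFne : PowerSeries.coeff (k n) F ≠ 0 := fun h0 => by simp [h0] at hC
  have hGne : PowerSeries.coeff (l m) G ≠ 0 := fun h0 => by simp [h0] at hD
  rw [shiftedVal_eq hα hFne, shiftedVal_eq hβ hGne] at ha hb
  rw [hα] at hF hG hr ⊢
  rw [hβ] at hr
  have hmem : ∀ x : ℂ_[p], x ∈ circleC p (α : EReal) ↔ ‖x‖ = (p : ℝ) ^ (-α) :=
    fun x => mem_circleC_iff
  obtain ⟨x₀, hx₀⟩ := hFI.exists_norm_eq hkn hρ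
  have hF0 := tendsto_weight_of_convergesAt (hF x₀ ((hmem x₀).2 hx₀))
  have hG0 := tendsto_weight_of_convergesAt (hG x₀ ((hmem x₀).2 hx₀))
  rw [hx₀] at hF0 hG0
  obtain ⟨Z, hZcard, hZ, hZpoly, hFZ⟩ := hFI.circlePoly hF0
  obtain ⟨W, hWcard, hW, hWpoly, hGW⟩ := hGI.circlePoly hG0
  rw [hZpoly, hWpoly] at hr
  have hrn : vp r = normVal p (Z.map (distProd W)).prod := by
    rw [vp_eq_normVal, hr, norm_resultant_prod_linear]
  have hphi : ∀ x : ℂ_[p], ‖x‖ = (p : ℝ) ^ (-α) → phi F G x =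
      min (normVal p (‖PowerSeries.coeff (k n) F‖ * ((p : ℝ) ^ (-α)) ^ k (n - 1)) +
          normVal p (distProd Z x))
        (normVal p (‖PowerSeries.coeff (l m) G‖ * ((p : ℝ) ^ (-α)) ^ l (m - 1)) +
          normVal p (distProd W x)) := fun x hx => by
    rw [phi, vp_eq_normVal, vp_eq_normVal, hFZ x hx, hGW x hx,
      ← normVal_mul hC (distProd_nonneg Z x), ← normVal_mul hD (distProd_nonneg W x)]
    rfl
  set ρ := (p : ℝ) ^ (-α) with hρdef
  set A := normVal p (‖PowerSeries.coeff (k n) F‖ * ρ ^ k (n - 1))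
  set B := normVal p (‖PowerSeries.coeff (l m) G‖ * ρ ^ l (m - 1))
  set R := (Z.map (distProd W)).prod with hRdef
  have hR0 : 0 ≤ R := Multiset.prod_map_nonneg fun z _ => distProd_nonneg W z
  have hZ0 : Z ≠ 0 := by rw [← Multiset.card_pos, hZcard]; omega
  have hW0 : W ≠ 0 := by rw [← Multiset.card_pos, hWcard]; omega
  have hT : ∀ y ∈ Z + W, ‖y‖ = ρ := fun y hy =>
    (Multiset.mem_add.1 hy).elim (hZ y) (hW y)
  -- The maximum over the finitely many zeros is the maximum over the circle, by the nearest-point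
  -- argument.
  obtain ⟨y₀, hy₀, hmax⟩ := (Z + W).toFinset.exists_max_image (phi F G) (by simp [hZ0])
  rw [Multiset.mem_toFinset] at hy₀
  have hgreat : ∀ x : ℂ_[p], ‖x‖ = ρ → phi F G x ≤ phi F G y₀ := fun x hx => by
    obtain ⟨y, hy, hyZ, hyW⟩ := exists_mem_distProd_le (W := W) hZ0 x
    refine le_trans ?_ (hmax y (Multiset.mem_toFinset.2 hy))
    rw [hphi x hx, hphi y (hT y hy)]
    exact min_le_min (add_le_add le_rfl (normVal_anti (distProd_nonneg Z y) hyZ))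
      (add_le_add le_rfl (normVal_anti (distProd_nonneg W y) hyW))
  have hy₀ρ := hT y₀ hy₀
  have hlower : ∀ {V V' : Multiset ℂ_[p]} {d : ℕ}, V ≠ 0 → V.card = d →
      (V.map (distProd V')).prod = R → ∃ z ∈ V, normVal p R / ((d : ℝ) : EReal) ≤
        normVal p (distProd V' z) := by
    intro V V' d hV hd hVR
    obtain ⟨z, hz, hle⟩ := Multiset.exists_pow_card_le_prod_map hV
      (fun z _ => distProd_nonneg V' z)
    have hdpos : 0 < d := hd ▸ Multiset.card_pos.2 hV
    refine ⟨z, hz, ?_⟩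
    rw [normVal_div (mod_cast hdpos) hR0]
    refine normVal_anti (distProd_nonneg V' z) ?_
    rw [hd, hVR] at hle
    calc distProd V' z = (distProd V' z ^ d) ^ ((d : ℝ)⁻¹) :=
          (Real.pow_rpow_inv_natCast (distProd_nonneg V' z) hdpos.ne').symm
      _ ≤ _ := Real.rpow_le_rpow (pow_nonneg (distProd_nonneg V' z) d) hle (by positivity)
  have hupper : ∀ c : ℝ, 0 < c → R ^ c ≤ max (distProd Z y₀) (distProd W y₀) →
      phi F G y₀ ≤ b + (c : EReal) * vp r := by
    intro c hc hle
    have hRc := Real.rpow_nonneg hR0 c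
    rw [hphi y₀ hy₀ρ, hrn, ← normVal_rpow hc hR0, hb]
    rcases le_max_iff.1 hle with h | h
    · exact (min_le_left _ _).trans (add_le_add (le_max_left _ _) (normVal_anti hRc h))
    · exact (min_le_right _ _).trans (add_le_add (le_max_right _ _) (normVal_anti hRc h))
  refine ⟨phi F G y₀, ⟨⟨y₀, (hmem y₀).2 hy₀ρ, rfl⟩, ?_⟩, ?_, fun hα0 => ?_⟩
  · rintro _ ⟨x, hx, rfl⟩
    exact hgreat x ((hmem x).1 hx)
  · rw [hrn, ha]
    rcases min_choice ((l m : ℝ) - (l (m - 1) : ℝ)) ((k n : ℝ) - (k (n - 1) : ℝ)) with h | h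
    · rw [h, ← Nat.cast_sub hlm.le]
      -- `W` has the smaller degree in this case. At its point `w` the value of `G` is 0, so φ(w) is
      -- the valuation of F(w).
      obtain ⟨w, hw, hle⟩ := hlower hW0 hWcard (prod_distProd_comm Z W).symm
      refine le_trans ?_ (hgreat w (hW w hw))
      rw [hphi w (hW w hw), distProd_eq_zero_iff.2 hw, normVal_zero]
      refine le_min (add_le_add (min_le_left _ _) hle) ?_
      rw [EReal.add_top_of_ne_bot]
      · exact le_top
      · simp only [B, normVal_of_pos hD]; exact EReal.coe_ne_bot _
    · rw [h, ← Nat.cast_sub hkn.le]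
      obtain ⟨z, hz, hle⟩ := hlower hZ0 hZcard rfl
      refine le_trans ?_ (hgreat z (hZ z hz))
      rw [hphi z (hZ z hz), distProd_eq_zero_iff.2 hz, normVal_zero]
      refine le_min ?_ (add_le_add (min_le_right _ _) hle)
      rw [EReal.add_top_of_ne_bot]
      · exact le_top
      · simp only [A, normVal_of_pos hC]; exact EReal.coe_ne_bot _
  · have hρ1 : ρ ≤ 1 :=
      Real.rpow_le_one_of_one_le_of_nonpos h1p.le (neg_nonpos.2 (by exact_mod_cast hα0))
    refine ⟨?_, fun K _ ϖ hϖ hFK hGK => ?_⟩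
    · have := hupper 1 one_pos (prod_distProd_rpow_le hZ0
        (fun y hy => prod_distProd_le_of_mem hρ1 hZ hW hy)
        (fun y hy => prod_distProd_le_of_mem hρ1 hW hZ hy) y₀)
      rwa [EReal.coe_one, one_mul] at this
    · have hdeg : ∀ z : ℂ_[p], ‖z‖ = ρ → IsIntegral K z →
          1 ≤ ((minpoly K z).natDegree : ℝ) * max (gcdRatio ϖ F k n) (gcdRatio ϖ G l m) :=
        fun z hz hint => (one_le_natDegree_mul_gcdRatio hϖ hFK hkn hFI hz hint).trans
          (mul_le_mul_of_nonneg_left (le_max_left _ _) (Nat.cast_nonneg _))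
      have hc : 0 < max (gcdRatio ϖ F k n) (gcdRatio ϖ G l m) :=
        lt_max_of_lt_left (gcdRatio_pos hkn)
      exact hupper _ hc (prod_distProd_rpow_le_of_rational hρ hρ1 hFI hGI hkn hF0 hG0 hFK hGK
        hZ hW hFZ hGW hc.le hdeg hy₀ρ)
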